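/- Let $(\Phi,\preccurlyeq)$ be a totally ordered set. The Hahn group $\mathbf H(\Phi)$ is the group of formal products $\gamma=\prod_{\phi\in\Phi}\phi^{\gamma_\phi}$ with $\gamma_\phi\in\mathbb R$ and anti-well-ordered support, with pointwise multiplication and the anti-lexicographic order (elements are compared at the largest $\phi$ where their exponents differ). Let $\Gamma$ be a subgroup of $\mathbf H(\Phi)$ containing $\Phi$, and let $\mathbb K=\mathbb R((\Gamma))$ be the field of generalized series $a=\sum_{\alpha\in\Gamma}a_\alpha\alpha$ with real coefficients and anti-well-ordered support; its elements with positive leading coefficient are called positive. For $a\neq0$ let $\mathrm{LM}(a)$ be the largest element of its support. Write $a\preccurlyeq b$ for $\mathrm{LM}(a)\preccurlyeq\mathrm{LM}(b)$ (and $0\preccurlyeq b$ for all $b$), $a\asymp b$ for $\mathrm{LM}(a)=\mathrm{LM}(b)$ (and $0\asymp 0$), $|a|=\max(\mathrm{LM}(a),\mathrm{LM}(a)^{-1})$, and call $a,b$ comparable if $\mathrm{LM}(a)$ and $\mathrm{LM}(b)$ have supports in $\Phi$ with the same maximum. A derivation $a\mapsto a'$ of $\mathbb K$ is - a series derivation if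 $1'=0$, $\alpha'=\alpha\sum_\phi\alpha_\phi\frac{\phi'}{\phi}$ for all $\alpha=\prod\phi^{\alpha_\phi}\in\Gamma$, and $a'=\sum_\alpha a_\alpha\alpha'$ for all $a\in\mathbb K$ (all the families being summable); - of Hardy type if its constants are exactly $\mathbb R$; $a\preccurlyeq b\Leftrightarrow a'\preccurlyeq b'$ for all nonzero $a,b\not\asymp1$; and, for all nonzero $a,b$ with $|a|\succ|b|\succ1$, $\frac{a'}a\succcurlyeq\frac{b'}b$, with $\frac{a'}a\asymp\frac{b'}b$ if and only if $a$ and $b$ are comparable; - monomial if $\phi'\in\mathbb R^*\cdot\Gamma$ for all $\phi\in\Phi$. Let $\sigma$ be a decreasing automorphism of $\Phi$, i.e. an order automorphism with $\sigma(\phi)\prec\phi$ for all $\phi$. The induced pre-logarithm $l_\sigma$ is defined on positive elements by $$l_\sigma(r\alpha(1+\epsilon))=\log r+\sum_\phi\alpha_\phi\,\sigma(\phi)+\sum_{n\ge1}\frac{(-1)^{n-1}}n\epsilon^n\qquad(r\in\mathbb R_{>0},\ \alpha=\prod\phi^{\alpha_\phi}\in\Gamma,\ \epsilon\prec1),$$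 and a derivation is log-compatible if $l_\sigma(a)'=a'/a$ for all positive $a$. Let $\mathcal D$ be the set of log-compatible monomial Hardy type series derivations on $\mathbb K$. The $\mathbb Z$-orbit of $\phi$ is $\{\sigma^k(\phi)\mid k\in\mathbb Z\}$, and its convex orbit is $\mathcal C_\phi=\{\psi\mid\exists k\in\mathbb N,\ \sigma^k(\phi)\preccurlyeq\psi\preccurlyeq\sigma^{-k}(\phi)\}$; the convex orbits partition $\Phi$. For $\alpha\in\mathbf H(\Phi)$ let $\mathrm{Tr}_{\succcurlyeq\mathcal C_\psi}(\alpha)$ be obtained from $\alpha$ by keeping only the factors $\chi^{\alpha_\chi}$ such that $\chi\succcurlyeq\psi'$ for some $\psi'\in\mathcal C_\psi$. A map $\Phi\to\Gamma$, $\phi\mapsto\theta^{(\phi)}$, satisfies (M) if - for all $\phi\prec\psi$ in $\Phi$: $\ \mathrm{Tr}_{\succcurlyeq\mathcal C_\psi}\left(\frac{\theta^{(\psi)}}{\theta^{(\phi)}}\right)=\mathrm{Tr}_{\succcurlyeq\mathcal C_\psi}\left(\prod_{j=1}^\infty\frac{\sigma^j(\psi)}{\sigma^j(\phi)}\right)$,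 and - for all $\phi\in\Phi$ and $k\in\mathbb N$: $\ \theta^{(\sigma^k(\phi))}=\theta^{(\phi)}\big/\prod_{j=1}^k\sigma^j(\phi)$. Then: 1. $\mathcal D\neq\emptyset$ if and only if there is a map $\Phi\to\Gamma$ satisfying (M). 2. For every $d\in\mathcal D$ there are a map $\theta$ satisfying (M) and reals $t_\phi\neq0$ with $\phi'/\phi=t_\phi\theta^{(\phi)}$ for all $\phi\in\Phi$. 3. Let $\mathcal F\subset\Phi$ be a family of representatives of the convex orbits and $\mathcal S_{\mathcal F}=\bigcup_{\phi\in\mathcal F}\{\psi\mid\phi\preccurlyeq\psi\prec\sigma^{-1}(\phi)\}$. Then $\mathcal S_{\mathcal F}$ is a family of representatives of the $\mathbb Z$-orbits; two elements of $\mathcal D$ for which $\psi'/\psi$ agrees for every $\psi\in\mathcal S_{\mathcal F}$ are equal; and for every $\theta$ satisfying (M) and arbitrary $t_\psi\in\mathbb R^*$ ($\psi\in\mathcal S_{\mathcal F}$) there is exactly one $d\in\mathcal D$ with $\psi'/\psi=t_\psi\theta^{(\psi)}$ for all $\psi\in\mathcal S_{\mathcal F}$. 4. Suppose that $\Phi=\mathcal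 C_\phi$ for some $\phi\in\Phi$, and for $d\in\mathcal D$ write $\psi'/\psi=t_\psi\theta^{(\psi)}$ with $t_\psi\in\mathbb R^*$, $\theta^{(\psi)}\in\Gamma$. Then $\theta^{(\psi)}=\theta^{(\phi)}\prod_{k=1}^\infty\frac{\sigma^k(\psi)}{\sigma^k(\phi)}$ for every $d\in\mathcal D$ and $\psi\in\Phi$. Moreover, if $\mathcal D\neq\emptyset$, then for every choice of $\theta_0\in\Gamma$ and of $t_\psi\in\mathbb R^*$ for $\phi\preccurlyeq\psi\prec\sigma^{-1}(\phi)$ there is exactly one $d\in\mathcal D$ with $\theta^{(\phi)}=\theta_0$ and these values $t_\psi$. -/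

import Mathlib

namespace HahnHardy

open HahnSeries

noncomputable section

/-! ### The Hahn group

Groups of monomials are written additively: the product `α β` of the mathematics is `α + β`, the
quotient `α / β` is `α - β`, and the monomial `1` is `0`. Mathlib's `HahnSeries` have well-ordered
support, so anti-well-ordered supports are obtained by dualizing the index order. -/

/-- The Hahn group over the chain `Φ`: formal products `∏ φ ^ γ_φ` with real exponents and
anti-well-ordered support, with the anti-lexicographic order (two elements are compared at the
largest `φ : Φ` at which their exponents differ). -/
abbrev HahnGroup (Φ : Type*) [LinearOrder Φ] : Type _ := Lex (HahnSeries Φᵒᵈ ℝ)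

variable {Φ : Type*} [LinearOrder Φ]

/-- The exponent of the fundamental monomial `φ` in `γ`. -/
def exponent (γ : HahnGroup Φ) (φ : Φ) : ℝ := (ofLex γ).coeff (OrderDual.toDual φ)

/-- The fundamental monomial `φ`, as an element of the Hahn group. -/
def fund (φ : Φ) : HahnGroup Φ := toLex (single (OrderDual.toDual φ) (1 : ℝ))

/-- The leading fundamental monomial `LF γ = max (supp γ)`. It takes values in `Φᵒᵈ` with an
additional element `⊤`, which stands for `1` and is the value at the monomial `1`. -/
def LF (γ : HahnGroup Φ) : WithTop Φᵒᵈ := (ofLex γ).orderTop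

/-- The truncation of `α` to a set `S` of fundamental monomials: the exponents of the elements
of `S` are kept, the others are replaced by `0`. -/
def truncation (S : Set Φ) (α : HahnGroup Φ) : HahnGroup Φ :=
  toLex
    { coeff := Set.indicator (OrderDual.ofDual ⁻¹' S) (ofLex α).coeff
      isPWO_support' := (ofLex α).isPWO_support.mono (by
        intro x hx
        have hx' : Set.indicator (OrderDual.ofDual ⁻¹' S) (ofLex α).coeff x ≠ 0 := hx
        exact fun h => hx' (by
          by_cases hS : x ∈ OrderDual.ofDual ⁻¹' S
          · rw [Set.indicator_of_mem hS]; exact h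
          · exact Set.indicator_of_notMem hS _)) }

theorem fund_strictMono : StrictMono (fund : Φ → HahnGroup Φ) := by
  intro φ ψ h
  rw [HahnSeries.lt_iff]
  refine ⟨OrderDual.toDual ψ, fun j hj => ?_, ?_⟩
  · have h1 : j ≠ OrderDual.toDual ψ := ne_of_lt hj
    have h2 : j ≠ OrderDual.toDual φ :=
      ne_of_lt (lt_trans hj (OrderDual.toDual_lt_toDual.mpr h))
    simp [fund, h1, h2]
  · have h1 : OrderDual.toDual ψ ≠ OrderDual.toDual φ :=
      fun e => h.ne' (OrderDual.toDual.injective e)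
    simp [fund, h1]

/-! ### Decreasing automorphisms -/

/-- An automorphism `σ` of the chain `Φ` is decreasing if `σ φ ≺ φ` for all `φ`. -/
def IsDecreasing (σ : Φ ≃o Φ) : Prop := ∀ φ, σ φ < φ

/-- The `ℤ`-orbit of `φ`. -/
def zOrbit (σ : Φ ≃o Φ) (φ : Φ) : Set Φ :=
  {ψ | ∃ k : ℕ, ψ = σ^[k] φ ∨ ψ = σ.symm^[k] φ}

/-- The convex orbit of `φ`. -/
def convexOrbit (σ : Φ ≃o Φ) (φ : Φ) : Set Φ :=
  {ψ | ∃ k : ℕ, σ^[k] φ ≤ ψ ∧ ψ ≤ σ.symm^[k] φ}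

/-- The fundamental monomials that lie in the convex orbit of `ψ` or above it. -/
def geConvexOrbit (σ : Φ ≃o Φ) (ψ : Φ) : Set Φ :=
  {χ | ∃ ψ' ∈ convexOrbit σ ψ, ψ' ≤ χ}

/-- `F` is a family of representatives of the convex orbits. -/
def IsConvexOrbitReps (σ : Φ ≃o Φ) (F : Set Φ) : Prop :=
  ∀ χ : Φ, ∃! φ, φ ∈ F ∧ χ ∈ convexOrbit σ φ

/-- `S` is a family of representatives of the `ℤ`-orbits. -/
def IsZOrbitReps (σ : Φ ≃o Φ) (S : Set Φ) : Prop :=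
  ∀ χ : Φ, ∃! φ, φ ∈ S ∧ χ ∈ zOrbit σ φ

/-- The union over `φ ∈ F` of the intervals `{ψ | φ ≼ ψ ≺ σ⁻¹ φ}`. -/
def fundDomain (σ : Φ ≃o Φ) (F : Set Φ) : Set Φ :=
  ⋃ φ ∈ F, Set.Ico φ (σ.symm φ)

theorem iterate_strictAnti {σ : Φ ≃o Φ} (hσ : IsDecreasing σ) (φ : Φ) :
    StrictAnti (fun j : ℕ => σ^[j] φ) := by
  refine strictAnti_nat_of_succ_lt fun n => ?_
  rw [Function.iterate_succ_apply']
  exact hσ _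

/-- The family `σ (φ), σ² (φ), σ³ (φ), …` in the Hahn group. -/
def orbitFamily {σ : Φ ≃o Φ} (hσ : IsDecreasing σ) (φ : Φ) : SummableFamily Φᵒᵈ ℝ ℕ where
  toFun j := ofLex (fund (σ^[j + 1] φ))
  isPWO_iUnion_support' := by
    have hm : Monotone (fun j : ℕ => OrderDual.toDual (σ^[j + 1] φ)) := fun a b hab =>
      OrderDual.toDual_le_toDual.mpr ((iterate_strictAnti hσ φ).antitone (by omega))
    refine ((Set.isPWO_of_wellQuasiOrderedLE (Set.univ : Set ℕ)).image_of_monotone hm).mono ?_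
    intro x hx
    obtain ⟨j, hj⟩ := Set.mem_iUnion.mp hx
    exact ⟨j, trivial, (support_single_subset hj).symm⟩
  finite_co_support' g := by
    refine Set.Subsingleton.finite fun i hi j hj => ?_
    have hi' : g = OrderDual.toDual (σ^[i + 1] φ) := by
      by_contra h; exact hi (coeff_single_of_ne h)
    have hj' : g = OrderDual.toDual (σ^[j + 1] φ) := by
      by_contra h; exact hj (coeff_single_of_ne h)
    exact Nat.succ_injective
      ((iterate_strictAnti hσ φ).injective (OrderDual.toDual.injective (hi'.symm.trans hj')))

/-- The infinite product `∏_{j ≥ 1} σ^j (ψ) / σ^j (φ)` in the Hahn group. -/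
def orbitRatio {σ : Φ ≃o Φ} (hσ : IsDecreasing σ) (ψ φ : Φ) : HahnGroup Φ :=
  toLex (orbitFamily hσ ψ - orbitFamily hσ φ).hsum

/-- Condition (M) on a map `φ ↦ θ^(φ)` from `Φ` to a group `Γ` of monomials. -/
structure ConditionM {σ : Φ ≃o Φ} (hσ : IsDecreasing σ) {Γ : AddSubgroup (HahnGroup Φ)}
    (θ : Φ → Γ) : Prop where
  /-- For `φ ≺ ψ`, the monomials `θ^(ψ) / θ^(φ)` and `∏_{j ≥ 1} σ^j (ψ) / σ^j (φ)` have the same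
  truncation to the fundamental monomials in or above the convex orbit of `ψ`. -/
  trunc_eq : ∀ φ ψ : Φ, φ < ψ →
    truncation (geConvexOrbit σ ψ) ((θ ψ : HahnGroup Φ) - (θ φ : HahnGroup Φ)) =
      truncation (geConvexOrbit σ ψ) (orbitRatio hσ ψ φ)
  /-- `θ^(σ^k φ) = θ^(φ) / ∏_{1 ≤ j ≤ k} σ^j (φ)`. -/
  iterate_eq : ∀ (φ : Φ) (k : ℕ),
    (θ (σ^[k] φ) : HahnGroup Φ) =
      (θ φ : HahnGroup Φ) - ∑ j ∈ Finset.Icc 1 k, fund (σ^[j] φ)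

/-! ### The field of generalized series -/

/-- The field `ℝ((Γ))` of generalized series with real coefficients, monomials in `Γ` and
anti-well-ordered support. -/
abbrev GenSeries (Γ : AddSubgroup (HahnGroup Φ)) : Type _ := HahnSeries (↥Γ)ᵒᵈ ℝ

variable {Γ : AddSubgroup (HahnGroup Φ)}

/-- The series `r α` with a single term. -/
def monTerm (r : ℝ) (α : Γ) : GenSeries Γ := single (OrderDual.toDual α) r

/-- The leading monomial of a nonzero series (the largest element of its support). -/
def LM (a : GenSeries Γ) : Γ := OrderDual.ofDual a.order

/-- The leading coefficient. -/
def LC (a : GenSeries Γ) : ℝ := a.leadingCoeff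

/-- The dominance relation `a ≼ b`; in the dualized order, a larger leading monomial is a smaller
`orderTop`, and `0` is dominated by everything. -/
def Dominated (a b : GenSeries Γ) : Prop := b.orderTop ≤ a.orderTop

/-- `a ≍ b`. -/
def AsympEq (a b : GenSeries Γ) : Prop := a.orderTop = b.orderTop

/-- `a` and `b` have the same leading fundamental monomial. -/
def Comparable (a b : GenSeries Γ) : Prop :=
  LF (LM a : HahnGroup Φ) = LF (LM b : HahnGroup Φ)

/-- The family `f` is summable with sum `s`. -/
def IsFamilySum {ι : Type*} (f : ι → GenSeries Γ) (s : GenSeries Γ) : Prop :=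
  ∃ 𝓕 : SummableFamily (↥Γ)ᵒᵈ ℝ ι, (∀ i, 𝓕 i = f i) ∧ 𝓕.hsum = s

/-- `Γ` contains the fundamental monomials. -/
def ContainsFund (Γ : AddSubgroup (HahnGroup Φ)) : Prop := ∀ φ : Φ, fund φ ∈ Γ

/-- The fundamental monomial `φ` as an element of `Γ`. -/
def fundMon (hΓ : ContainsFund Γ) (φ : Φ) : Γ := ⟨fund φ, hΓ φ⟩

/-- The fundamental monomial `φ` as a generalized series. -/
def fundSeries (hΓ : ContainsFund Γ) (φ : Φ) : GenSeries Γ := monTerm 1 (fundMon hΓ φ)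

/-! ### The pre-logarithm induced by a decreasing automorphism -/

theorem fundMon_strictMono (hΓ : ContainsFund Γ) : StrictMono (fundMon hΓ) :=
  fun _ _ h => fund_strictMono h

/-- For `α = ∏ φ ^ α_φ`, the family `α_φ σ(φ)`, `φ ∈ Φ`, of generalized series. -/
def prelogFamily (hΓ : ContainsFund Γ) (σ : Φ ≃o Φ) (α : Γ) :
    SummableFamily (↥Γ)ᵒᵈ ℝ Φ where
  toFun φ := monTerm (exponent (α : HahnGroup Φ) φ) (fundMon hΓ (σ φ))
  isPWO_iUnion_support' := by
    have hm : Monotone (fun x : Φᵒᵈ =>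
        OrderDual.toDual (fundMon hΓ (σ (OrderDual.ofDual x)))) := fun a b hab =>
      OrderDual.toDual_le_toDual.mpr
        ((fundMon_strictMono hΓ).monotone (σ.monotone (OrderDual.ofDual_le_ofDual.mpr hab)))
    refine ((ofLex (α : HahnGroup Φ)).isPWO_support.image_of_monotone hm).mono ?_
    intro x hx
    obtain ⟨φ, hφ⟩ := Set.mem_iUnion.mp hx
    refine ⟨OrderDual.toDual φ, fun h0 => hφ ?_, (support_single_subset hφ).symm⟩
    have h1 : exponent (α : HahnGroup Φ) φ = 0 := h0
    simp [monTerm, h1]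
  finite_co_support' g := by
    refine Set.Subsingleton.finite fun i hi j hj => ?_
    have hi' : g = OrderDual.toDual (fundMon hΓ (σ i)) := by
      by_contra h; exact hi (by simp [monTerm, h])
    have hj' : g = OrderDual.toDual (fundMon hΓ (σ j)) := by
      by_contra h; exact hj (by simp [monTerm, h])
    exact σ.injective ((fundMon_strictMono hΓ).injective
      (OrderDual.toDual.injective (hi'.symm.trans hj')))

/-- The pre-logarithmic section `l_σ (∏ φ ^ α_φ) = ∑ α_φ σ(φ)`. -/
def prelogSection (hΓ : ContainsFund Γ) (σ : Φ ≃o Φ) (α : Γ) : GenSeries Γ :=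
  (prelogFamily hΓ σ α).hsum

/-- The logarithm on `1`-units, `1 + ε ↦ ∑_{n ≥ 1} (-1)^(n-1) ε^n / n`, as a function of an
infinitesimal `ε` (for `ε ≺ 1`, Mathlib's `SummableFamily.powers ε` is the family `(ε ^ n)_n`). -/
def logOneAdd (ε : GenSeries Γ) : GenSeries Γ :=
  (SummableFamily.smulFamily (fun n : ℕ => if n = 0 then (0 : ℝ) else (-1) ^ (n - 1) / (n : ℝ))
    (SummableFamily.powers ε)).hsum

/-- The pre-logarithm induced by `l_σ`: if `a = r α (1 + ε)` with `r > 0` real, `α ∈ Γ` and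
`ε ≺ 1`, then `l (a) = log r + l_σ (α) + log (1 + ε)`. Only meant for positive `a`. -/
def prelog (hΓ : ContainsFund Γ) (σ : Φ ≃o Φ) (a : GenSeries Γ) : GenSeries Γ :=
  C (Real.log (LC a)) + prelogSection hΓ σ (LM a) + logOneAdd (a / monTerm (LC a) (LM a) - 1)

/-! ### Derivations -/

/-- Series derivations. The families in (D1) and (D2) are indexed by all of `Φ` and `Γ`; their
members outside the support of `α`, respectively of `a`, vanish. -/
structure IsSeriesDerivation (hΓ : ContainsFund Γ) (d : GenSeries Γ → GenSeries Γ) : Prop where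
  /-- (D0) -/
  map_one : d 1 = 0
  /-- (D1), the strong Leibniz rule: `α' = α ∑ α_φ φ'/φ`. -/
  strong_leibniz : ∀ α : Γ, ∃ s : GenSeries Γ,
    IsFamilySum (fun φ : Φ =>
      exponent (α : HahnGroup Φ) φ • (d (fundSeries hΓ φ) / fundSeries hΓ φ)) s ∧
    d (monTerm 1 α) = monTerm 1 α * s
  /-- (D2), strong linearity: `a' = ∑ a_α α'`. -/
  strong_linear : ∀ a : GenSeries Γ,
    IsFamilySum (fun α : Γ => a.coeff (OrderDual.toDual α) • d (monTerm 1 α)) (d a)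

/-- Hardy type derivations. -/
structure IsHardyType (d : Derivation ℤ (GenSeries Γ) (GenSeries Γ)) : Prop where
  /-- (HD1): the constants are the real numbers. -/
  constants : ∀ a : GenSeries Γ, d a = 0 ↔ ∃ r : ℝ, a = C r
  /-- (HD2), l'Hospital's rule. -/
  lhospital : ∀ a b : GenSeries Γ, a ≠ 0 → b ≠ 0 → ¬ AsympEq a 1 → ¬ AsympEq b 1 →
    (Dominated a b ↔ Dominated (d a) (d b))
  /-- (HD3): if `|a| ≻ |b| ≻ 1` then `a'/a ≽ b'/b`, with `≍` if and only if `a` and `b` are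
  comparable; here `|a| = max (LM a, (LM a)⁻¹)`. -/
  log_deriv : ∀ a b : GenSeries Γ, a ≠ 0 → b ≠ 0 → 0 < |LM b| → |LM b| < |LM a| →
    Dominated (d b / b) (d a / a) ∧ (AsympEq (d a / a) (d b / b) ↔ Comparable a b)

/-- Monomial derivations: every fundamental monomial has its derivative in `ℝ^* Γ`. -/
def IsMonomialDeriv (hΓ : ContainsFund Γ) (d : GenSeries Γ → GenSeries Γ) : Prop :=
  ∀ φ : Φ, ∃ (t : ℝ) (α : Γ), t ≠ 0 ∧ d (fundSeries hΓ φ) = monTerm t α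

/-- `d` is compatible with the pre-logarithm `l_σ`: `l_σ(a)' = a'/a` for all `a > 0`. -/
def IsLogCompatible (hΓ : ContainsFund Γ) (σ : Φ ≃o Φ) (d : GenSeries Γ → GenSeries Γ) : Prop :=
  ∀ a : GenSeries Γ, 0 < LC a → d (prelog hΓ σ a) = d a / a

/-- Log-compatible monomial Hardy type series derivations. -/
structure IsLogMonomialHardy (hΓ : ContainsFund Γ) (σ : Φ ≃o Φ)
    (d : Derivation ℤ (GenSeries Γ) (GenSeries Γ)) : Prop where
  series : IsSeriesDerivation hΓ d
  hardy : IsHardyType d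
  monomial : IsMonomialDeriv hΓ d
  logCompatible : IsLogCompatible hΓ σ d

/-- The logarithmic derivative `φ'/φ` of a fundamental monomial. -/
def logDerivFund (hΓ : ContainsFund Γ) (d : Derivation ℤ (GenSeries Γ) (GenSeries Γ)) (φ : Φ) :
    GenSeries Γ :=
  d (fundSeries hΓ φ) / fundSeries hΓ φ

end

end HahnHardy

open HahnHardy

namespace HahnHardy
open HahnSeries
noncomputable section

section
variable {Φ : Type*} [LinearOrder Φ]

/-! ### Exponents in the Hahn group -/

/-! The pivot is a condition simpler than (M), `IsHardyMap`: `θ` is strictly increasing, and for φ ≺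
ψ the quotient θ^(ψ)/θ^(φ) is supported strictly below ψ. For maps obeying the recursion θ^(σφ) =
θ^(φ)/σ(φ) it is equivalent to (M). At an exponent χ ≽ σ^k(ψ) only the first k factors of ∏
σ^j(ψ)/σ^j(φ) are visible, and the recursion identifies them with the passage from (φ, ψ) to (σ^k φ,
σ^k ψ) (`ConditionM.isHardyMap`, `IsHardyMap.conditionM`).

Sufficiency. Put a' = ∑_φ t_φ θ^(φ) ∂_φ a, where ∂_φ α = α_φ α. The Hardy map condition makes this
family summable (`IsHardyMap.not_monotone`) and makes αθ^(ψ), with ψ the leading fundamental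
monomial of α = LM(a) ≠ 1, strictly dominate all other contributions (`IsHardyMap.add_lt_add`).
Hence LM(a') = LM(a) θ^(ψ), from which the Hardy axioms are read off. Log-compatibility amounts to
the recursion for θ together with the invariance of t under σ.

Necessity. Monomiality gives φ'/φ = t_φ θ^(φ). Comparing logarithmic derivatives of fundamental
monomials makes θ strictly increasing, and l'Hospital's rule applied to 1/φ and θ^(φ)/θ^(ψ) bounds
the support of the quotient (`IsHardyType.isHardyMap`). Since l_σ(φ) = σ(φ), log-compatibility at φ
reads σ(φ)' = φ'/φ, which is the recursion.

Uniqueness. A series derivation is determined by the φ'/φ, and log-compatibility carries these along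
ℤ-orbits, so values on orbit representatives suffice. With a single convex orbit the truncations in
(M) keep everything, so (M) fixes θ up to a constant factor. -/

@[simp] theorem exponent_zero (χ : Φ) : exponent (0 : HahnGroup Φ) χ = 0 := rfl

@[simp] theorem exponent_add (α β : HahnGroup Φ) (χ : Φ) :
    exponent (α + β) χ = exponent α χ + exponent β χ := rfl

@[simp] theorem exponent_sub (α β : HahnGroup Φ) (χ : Φ) :
    exponent (α - β) χ = exponent α χ - exponent β χ := by
  simp [exponent]

@[simp] theorem exponent_neg (α : HahnGroup Φ) (χ : Φ) :
    exponent (-α) χ = -exponent α χ := by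
  simp [exponent]

@[simp] theorem exponent_sum {ι : Type*} (s : Finset ι) (f : ι → HahnGroup Φ) (χ : Φ) :
    exponent (∑ i ∈ s, f i) χ = ∑ i ∈ s, exponent (f i) χ := by
  classical
  induction s using Finset.induction_on with
  | empty => simp
  | insert a s ha ih => rw [Finset.sum_insert ha, Finset.sum_insert ha, exponent_add, ih]

theorem exponent_ext {α β : HahnGroup Φ} (h : ∀ χ, exponent α χ = exponent β χ) : α = β := by
  apply ofLex.injective
  ext x
  exact h (OrderDual.ofDual x)

theorem exponent_fund_self (φ : Φ) : exponent (fund φ) φ = 1 := by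
  simp [exponent, fund]

theorem exponent_fund_of_ne {φ χ : Φ} (h : χ ≠ φ) : exponent (fund φ) χ = 0 := by
  simp [exponent, fund, h]

theorem lt_iff_exponent {α β : HahnGroup Φ} :
    α < β ↔ ∃ χ, (∀ ψ, χ < ψ → exponent α ψ = exponent β ψ) ∧ exponent α χ < exponent β χ := by
  rw [HahnSeries.lt_iff]
  exact Iff.rfl

/-- `χ` is the largest element of the support of `γ`. -/
def IsLeadingFund (γ : HahnGroup Φ) (χ : Φ) : Prop :=
  exponent γ χ ≠ 0 ∧ ∀ ψ, χ < ψ → exponent γ ψ = 0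

theorem LF_eq_coe_iff {γ : HahnGroup Φ} {χ : Φ} :
    LF γ = (OrderDual.toDual χ : Φᵒᵈ) ↔ IsLeadingFund γ χ := by
  constructor
  · intro h
    exact ⟨coeff_orderTop_ne h, fun ψ hψ => coeff_eq_zero_of_lt_orderTop (by
      have h' : (ofLex γ).orderTop = (OrderDual.toDual χ : Φᵒᵈ) := h
      rw [h']
      exact WithTop.coe_lt_coe.mpr (OrderDual.toDual_lt_toDual.mpr hψ))⟩
  · rintro ⟨h1, h2⟩
    refine orderTop_eq_of_le h1 fun g hg => ?_
    by_contra hlt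
    exact hg (h2 (OrderDual.ofDual g) (not_le.mp hlt))

theorem exists_isLeadingFund {γ : HahnGroup Φ} (h : γ ≠ 0) : ∃ χ, IsLeadingFund γ χ := by
  have hne : (ofLex γ).orderTop ≠ ⊤ := fun h0 => h (by
    apply ofLex.injective
    exact orderTop_eq_top.mp h0)
  obtain ⟨x, hx⟩ := WithTop.ne_top_iff_exists.mp hne
  exact ⟨OrderDual.ofDual x, LF_eq_coe_iff.mp hx.symm⟩

theorem IsLeadingFund.ne_zero {γ : HahnGroup Φ} {χ : Φ} (h : IsLeadingFund γ χ) : γ ≠ 0 := by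
  rintro rfl
  exact h.1 rfl

theorem IsLeadingFund.le {γ : HahnGroup Φ} {χ ψ : Φ} (h : IsLeadingFund γ χ)
    (hψ : exponent γ ψ ≠ 0) : ψ ≤ χ := by
  by_contra hlt
  exact hψ (h.2 ψ (not_le.mp hlt))

theorem IsLeadingFund.unique {γ : HahnGroup Φ} {χ ψ : Φ} (h : IsLeadingFund γ χ)
    (h' : IsLeadingFund γ ψ) : χ = ψ :=
  le_antisymm (h'.le h.1) (h.le h'.1)

theorem IsLeadingFund.neg {γ : HahnGroup Φ} {χ : Φ} (h : IsLeadingFund γ χ) :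
    IsLeadingFund (-γ) χ :=
  ⟨by simpa using h.1, fun ψ hψ => by simp [h.2 ψ hψ]⟩

theorem isLeadingFund_fund (φ : Φ) : IsLeadingFund (fund φ) φ :=
  ⟨by simp [exponent_fund_self], fun _ hψ => exponent_fund_of_ne hψ.ne'⟩

theorem IsLeadingFund.pos_iff {γ : HahnGroup Φ} {χ : Φ} (h : IsLeadingFund γ χ) :
    0 < γ ↔ 0 < exponent γ χ := by
  constructor
  · intro hpos
    obtain ⟨ψ, h1, h2⟩ := lt_iff_exponent.mp hpos
    have hψ : IsLeadingFund γ ψ := ⟨h2.ne', fun x hx => (h1 x hx).symm⟩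
    rw [h.unique hψ]
    exact h2
  · intro hpos
    exact lt_iff_exponent.mpr ⟨χ, fun ψ hψ => (h.2 ψ hψ).symm, hpos⟩

theorem fund_pos (φ : Φ) : 0 < fund φ :=
  (isLeadingFund_fund φ).pos_iff.mpr (by simp [exponent_fund_self])

theorem lt_of_isLeadingFund_lt {α β : HahnGroup Φ} {φ ψ : Φ} (hα : IsLeadingFund α φ)
    (hβ : IsLeadingFund β ψ) (h : φ < ψ) (hpos : 0 < β) : α < β :=
  lt_iff_exponent.mpr ⟨ψ, fun χ hχ => by rw [hα.2 χ (h.trans hχ), hβ.2 χ hχ], by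
    rw [hα.2 ψ h]
    exact hβ.pos_iff.mp hpos⟩

theorem IsLeadingFund.abs {γ : HahnGroup Φ} {χ : Φ} (h : IsLeadingFund γ χ) :
    IsLeadingFund |γ| χ := by
  rcases abs_choice γ with h' | h' <;> rw [h']
  · exact h
  · exact h.neg

theorem isLeadingFund_le_of_abs_lt {α β : HahnGroup Φ} {φ ψ : Φ} (hα : IsLeadingFund α φ)
    (hβ : IsLeadingFund β ψ) (h : |α| < |β|) : φ ≤ ψ := by
  by_contra hlt
  exact lt_asymm h (lt_of_isLeadingFund_lt hβ.abs hα.abs (not_le.mp hlt)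
    (abs_pos.mpr hα.ne_zero))

theorem LF_eq_LF_iff {α β : HahnGroup Φ} {φ ψ : Φ} (hα : IsLeadingFund α φ)
    (hβ : IsLeadingFund β ψ) : LF α = LF β ↔ φ = ψ := by
  rw [LF_eq_coe_iff.mpr hα, LF_eq_coe_iff.mpr hβ]
  simp

/-! ### Truncations and orbit ratios -/

theorem exponent_truncation_of_mem {S : Set Φ} (α : HahnGroup Φ) {χ : Φ} (h : χ ∈ S) :
    exponent (truncation S α) χ = exponent α χ :=
  Set.indicator_of_mem (s := OrderDual.ofDual ⁻¹' S) h _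

theorem exponent_truncation_of_notMem {S : Set Φ} (α : HahnGroup Φ) {χ : Φ} (h : χ ∉ S) :
    exponent (truncation S α) χ = 0 :=
  Set.indicator_of_notMem (s := OrderDual.ofDual ⁻¹' S) h _

theorem truncation_eq_iff {S : Set Φ} {α β : HahnGroup Φ} :
    truncation S α = truncation S β ↔ ∀ χ ∈ S, exponent α χ = exponent β χ := by
  constructor
  · intro h χ hχ
    rw [← exponent_truncation_of_mem α hχ, h, exponent_truncation_of_mem β hχ]
  · intro h
    refine exponent_ext fun χ => ?_
    by_cases hχ : χ ∈ S
    · rw [exponent_truncation_of_mem α hχ, h χ hχ, exponent_truncation_of_mem β hχ]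
    · rw [exponent_truncation_of_notMem α hχ, exponent_truncation_of_notMem β hχ]

variable {σ : Φ ≃o Φ} (hσ : IsDecreasing σ)

theorem orbitRatio_eq_sub (ψ φ : Φ) :
    orbitRatio hσ ψ φ = toLex (orbitFamily hσ ψ).hsum - toLex (orbitFamily hσ φ).hsum := by
  rw [eq_sub_iff_add_eq]
  apply ofLex.injective
  change (orbitFamily hσ ψ - orbitFamily hσ φ).hsum + (orbitFamily hσ φ).hsum = _
  rw [← SummableFamily.hsum_add, sub_add_cancel]
  rfl

/-- The factors σ^j(φ) with j > k lie strictly below σ^k(φ) ≼ χ, so they do not contribute at χ. -/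
theorem exponent_orbitFamily_hsum {φ χ : Φ} {k : ℕ} (h : σ^[k] φ ≤ χ) :
    exponent (toLex (orbitFamily hσ φ).hsum) χ =
      ∑ j ∈ Finset.Icc 1 k, exponent (fund (σ^[j] φ)) χ := by
  have h1 : exponent (toLex (orbitFamily hσ φ).hsum) χ =
      ∑ᶠ j : ℕ, exponent (fund (σ^[j + 1] φ)) χ := SummableFamily.coeff_hsum
  rw [h1, finsum_eq_sum_of_support_subset (s := Finset.range k), Finset.range_eq_Ico,
    Finset.sum_Ico_add' (fun j => exponent (fund (σ^[j] φ)) χ) 0 k 1]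
  · rfl
  · intro j hj
    by_contra hjk
    simp only [Finset.coe_range, Set.mem_Iio, not_lt] at hjk
    refine hj (exponent_fund_of_ne (ne_of_gt (lt_of_lt_of_le ?_ h)))
    exact iterate_strictAnti hσ φ (Nat.lt_succ_of_le hjk)

theorem exponent_orbitRatio {φ ψ χ : Φ} {k : ℕ} (hφ : σ^[k] φ ≤ χ) (hψ : σ^[k] ψ ≤ χ) :
    exponent (orbitRatio hσ ψ φ) χ =
      exponent (∑ j ∈ Finset.Icc 1 k, fund (σ^[j] ψ)) χ -
        exponent (∑ j ∈ Finset.Icc 1 k, fund (σ^[j] φ)) χ := by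
  rw [orbitRatio_eq_sub, exponent_sub, exponent_orbitFamily_hsum hσ hφ,
    exponent_orbitFamily_hsum hσ hψ, exponent_sum, exponent_sum]

theorem iterate_strictMono (k : ℕ) : StrictMono (σ^[k]) := σ.strictMono.iterate k

include hσ in
theorem iterate_le (φ : Φ) (k : ℕ) : σ^[k] φ ≤ φ :=
  (iterate_strictAnti hσ φ).antitone (Nat.zero_le k)

include hσ in
theorem le_symm_iterate (φ : Φ) (k : ℕ) : φ ≤ σ.symm^[k] φ := by
  have h := iterate_le hσ (σ.symm^[k] φ) k
  have h' : Function.LeftInverse σ σ.symm := σ.apply_symm_apply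
  rwa [h'.iterate k φ] at h

include hσ in
theorem mem_geConvexOrbit_iff {ψ χ : Φ} :
    χ ∈ geConvexOrbit σ ψ ↔ ∃ k : ℕ, σ^[k] ψ ≤ χ := by
  constructor
  · rintro ⟨ψ', ⟨k, hk, -⟩, h⟩
    exact ⟨k, hk.trans h⟩
  · rintro ⟨k, hk⟩
    exact ⟨σ^[k] ψ, ⟨k, le_rfl, (iterate_le hσ ψ k).trans (le_symm_iterate hσ ψ k)⟩, hk⟩

/-! ### Condition (M) and Hardy maps -/

variable {Γ : AddSubgroup (HahnGroup Φ)}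

/-- For `φ ≺ ψ`, `θ^(φ) ≺ θ^(ψ)` and the leading fundamental monomial of `θ^(ψ) / θ^(φ)` is
smaller than `ψ`. -/
def IsHardyMap (θ : Φ → Γ) : Prop :=
  ∀ φ ψ : Φ, φ < ψ → θ φ < θ ψ ∧
    ∀ χ, ψ ≤ χ → exponent (θ ψ : HahnGroup Φ) χ = exponent (θ φ : HahnGroup Φ) χ

theorem IsHardyMap.strictMono {θ : Φ → Γ} (h : IsHardyMap θ) : StrictMono θ :=
  fun φ ψ hφ => (h φ ψ hφ).1

theorem ConditionM.isHardyMap {θ : Φ → Γ} (h : ConditionM hσ θ) : IsHardyMap θ := by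
  intro φ ψ hφψ
  have key : ∀ k : ℕ, ∀ χ, σ^[k] ψ ≤ χ → exponent (θ ψ : HahnGroup Φ) χ -
      exponent (θ φ : HahnGroup Φ) χ = exponent (∑ j ∈ Finset.Icc 1 k, fund (σ^[j] ψ)) χ -
        exponent (∑ j ∈ Finset.Icc 1 k, fund (σ^[j] φ)) χ := by
    intro k χ hχ
    rw [← exponent_orbitRatio hσ (((iterate_strictMono k hφψ).le).trans hχ) hχ, ← exponent_sub]
    exact truncation_eq_iff.mp (h.trunc_eq φ ψ hφψ) χ ((mem_geConvexOrbit_iff hσ).mpr ⟨k, hχ⟩)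
  constructor
  · change (θ φ : HahnGroup Φ) < (θ ψ : HahnGroup Φ)
    -- With k = 1 the ratio is σ(ψ)/σ(φ), so θ^(ψ)/θ^(φ) has leading fundamental monomial σ(ψ), with
    -- exponent 1.
    refine lt_iff_exponent.mpr ⟨σ ψ, fun χ hχ => ?_, ?_⟩
    · have h1 := key 1 χ hχ.le
      have h2 : σ φ < χ := (σ.strictMono hφψ).trans hχ
      simp [exponent_fund_of_ne hχ.ne', exponent_fund_of_ne h2.ne'] at h1
      linarith
    · have h1 := key 1 (σ ψ) le_rfl
      simp [exponent_fund_self, exponent_fund_of_ne (σ.strictMono hφψ).ne'] at h1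
      linarith
  · intro χ hχ
    -- With k = 0 no factor of the orbit ratio is visible at or above ψ.
    have h1 := key 0 χ hχ
    simp at h1
    linarith

/-- Any χ in or above the convex orbit of ψ satisfies σ^k(ψ) ≼ χ for some k. The Hardy map condition
for σ^k(φ) ≺ σ^k(ψ) then gives equal exponents at χ, and unfolding the recursion k times turns this
equality into (M) at χ. -/
theorem IsHardyMap.conditionM {θ : Φ → Γ} (h : IsHardyMap θ)
    (hit : ∀ φ, (θ (σ φ) : HahnGroup Φ) = (θ φ : HahnGroup Φ) - fund (σ φ)) :
    ConditionM hσ θ := by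
  have hit' : ∀ (φ : Φ) (k : ℕ), (θ (σ^[k] φ) : HahnGroup Φ) =
      (θ φ : HahnGroup Φ) - ∑ j ∈ Finset.Icc 1 k, fund (σ^[j] φ) := by
    intro φ k
    induction k with
    | zero => simp
    | succ k ih =>
      rw [Function.iterate_succ_apply', hit, ih, Finset.sum_Icc_succ_top (by omega),
        Function.iterate_succ_apply']
      abel
  refine ⟨fun φ ψ hφψ => truncation_eq_iff.mpr fun χ hχ => ?_, hit'⟩
  obtain ⟨k, hk⟩ := (mem_geConvexOrbit_iff hσ).mp hχ
  have hlt := iterate_strictMono (σ := σ) k hφψ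
  rw [exponent_orbitRatio hσ (hlt.le.trans hk) hk]
  have h1 := (h _ _ hlt).2 χ hk
  rw [hit', hit', exponent_sub, exponent_sub] at h1
  rw [exponent_sub]
  linarith

/-! ### Summability -/

/-- The monomials supported strictly below χ form a convex subgroup: a positive α with leading
fundamental monomial at or above χ would exceed β. -/
theorem exponent_eq_zero_of_le {α β : HahnGroup Φ} {χ : Φ} (h0 : 0 ≤ α) (h : α ≤ β)
    (hβ : ∀ ψ, χ ≤ ψ → exponent β ψ = 0) {ψ : Φ} (hψ : χ ≤ ψ) : exponent α ψ = 0 := by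
  by_contra hne
  have hα : α ≠ 0 := by
    rintro rfl
    exact hne rfl
  obtain ⟨τ, hτ⟩ := exists_isLeadingFund hα
  have hχτ : χ ≤ τ := hψ.trans (hτ.le hne)
  have hpos := hτ.pos_iff.mp (lt_of_le_of_ne h0 hα.symm)
  exact absurd h (not_le.mpr (lt_iff_exponent.mpr
    ⟨τ, fun x hx => by rw [hτ.2 x hx, hβ x (hχτ.trans hx.le)], by rw [hβ τ hχτ]; exact hpos⟩))

theorem support_isPWO (α : HahnGroup Φ) : {x : Φᵒᵈ | exponent α (OrderDual.ofDual x) ≠ 0}.IsPWO :=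
  (ofLex α).isPWO_support

/-- Core of summability. Along a subsequence the α_n decrease weakly, so monotonicity of α_n θ^(φ_n)
forces the φ_n to increase strictly. Then 1 ≼ α_0/α_n ≼ θ^(φ_n)/θ^(φ_0), and the right side is
supported below φ_n. So α_0 and α_n have the same nonzero exponent at φ_n, and the support of α_0
contains a strictly increasing sequence, which is impossible. -/
theorem IsHardyMap.not_monotone {θ : Φ → Γ} (h : IsHardyMap θ) {S : Set (↥Γ)ᵒᵈ} (hS : S.IsPWO)
    {α : ℕ → Γ} {φ : ℕ → Φ} (hα : ∀ n, OrderDual.toDual (α n) ∈ S)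
    (hφ : ∀ n, exponent (α n : HahnGroup Φ) (φ n) ≠ 0)
    (hinj : Function.Injective fun n => (α n, φ n)) :
    ¬ Monotone fun n => α n + θ (φ n) := by
  intro hmono
  obtain ⟨g, hg⟩ := hS.exists_monotone_subseq (f := fun n => OrderDual.toDual (α n)) hα
  have hanti : ∀ m n, m ≤ n → α (g n) ≤ α (g m) := fun m n hmn => hg hmn
  have hlt : ∀ m n, m < n → φ (g m) < φ (g n) := by
    intro m n hmn
    have h1 : α (g m) + θ (φ (g m)) ≤ α (g n) + θ (φ (g n)) := hmono (g.monotone hmn.le)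
    have h2 := hanti m n hmn.le
    have h3 : θ (φ (g m)) ≤ θ (φ (g n)) := by
      by_contra hc
      exact absurd h1 (not_le.mpr (add_lt_add_of_le_of_lt h2 (not_le.mp hc)))
    refine lt_of_le_of_ne (h.strictMono.le_iff_le.mp h3) fun he => ?_
    rw [he] at h1
    have h4 : α (g m) = α (g n) := le_antisymm (le_of_add_le_add_right h1) h2
    exact (g.strictMono hmn).ne (hinj (Prod.ext h4 he))
  have hsupp : ∀ n, 0 < n → exponent (α (g 0) : HahnGroup Φ) (φ (g n)) ≠ 0 := by
    intro n hn
    have h1 : α (g 0) + θ (φ (g 0)) ≤ α (g n) + θ (φ (g n)) := hmono (g.monotone hn.le)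
    have h0 : α (g n) ≤ α (g 0) := hanti 0 n hn.le
    have h2 : (0 : HahnGroup Φ) ≤ (α (g 0) : HahnGroup Φ) - α (g n) := sub_nonneg.mpr h0
    have h3 : (α (g 0) : HahnGroup Φ) - α (g n) ≤ (θ (φ (g n)) : HahnGroup Φ) - θ (φ (g 0)) := by
      have h1' : (α (g 0) : HahnGroup Φ) + θ (φ (g 0)) ≤ α (g n) + θ (φ (g n)) := h1
      rw [sub_le_sub_iff, add_comm (θ (φ (g n)) : HahnGroup Φ)]
      exact h1'
    have h4 := exponent_eq_zero_of_le (χ := φ (g n)) h2 h3 (fun ψ hψ => by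
      rw [exponent_sub, (h _ _ (hlt 0 n hn)).2 ψ hψ, sub_self]) le_rfl
    rw [exponent_sub, sub_eq_zero] at h4
    rw [h4]
    exact hφ (g n)
  obtain ⟨k, hk⟩ := (support_isPWO (α (g 0) : HahnGroup Φ)).exists_monotone_subseq
    (f := fun n => OrderDual.toDual (φ (g (n + 1)))) (fun n => hsupp (n + 1) n.succ_pos)
  have h1 : φ (g (k 1 + 1)) ≤ φ (g (k 0 + 1)) := hk (Nat.zero_le 1)
  exact absurd h1 (not_le.mpr (hlt _ _ (Nat.succ_lt_succ (k.strictMono Nat.zero_lt_one))))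

theorem IsHardyMap.isPWO_image {θ : Φ → Γ} (h : IsHardyMap θ) {S : Set (↥Γ)ᵒᵈ} (hS : S.IsPWO) :
    {x : (↥Γ)ᵒᵈ | ∃ (α : Γ) (φ : Φ), OrderDual.toDual α ∈ S ∧ exponent (α : HahnGroup Φ) φ ≠ 0 ∧
      x = OrderDual.toDual (α + θ φ)}.IsPWO := by
  rw [Set.isPWO_iff_isWF, Set.isWF_iff_no_descending_seq]
  intro f hf hmem
  choose α φ hα hφ hx using hmem
  have hlt : StrictMono fun n => α n + θ (φ n) := by
    intro m n hmn
    have h1 := hf hmn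
    rw [hx, hx] at h1
    exact h1
  refine h.not_monotone hS hα hφ (fun m n hmn => ?_) hlt.monotone
  simp only [Prod.mk.injEq] at hmn
  exact hlt.injective (by simp only [hmn])

theorem IsHardyMap.finite_fiber {θ : Φ → Γ} (h : IsHardyMap θ) {S : Set (↥Γ)ᵒᵈ} (hS : S.IsPWO)
    (γ : Γ) : {φ : Φ | OrderDual.toDual (γ - θ φ) ∈ S ∧
      exponent ((γ - θ φ : Γ) : HahnGroup Φ) φ ≠ 0}.Finite := by
  by_contra hinf
  have hinf : Set.Infinite _ := hinf
  let e := hinf.natEmbedding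
  -- Infinitely many φ would give a sequence of products constantly equal to γ, hence monotone.
  refine h.not_monotone hS (α := fun n => γ - θ (e n)) (φ := fun n => e n)
    (fun n => (e n).2.1) (fun n => (e n).2.2) (fun m n hmn => ?_) (fun m n _ => by simp)
  simp only [Prod.mk.injEq] at hmn
  exact e.injective (Subtype.ext hmn.2)

/-! ### Shortcut instances

Instance search in `GenSeries Γ` is slow; these are made local instances below. -/

@[reducible] def dualLinearOrder : LinearOrder (↥Γ)ᵒᵈ := inferInstance

@[reducible] def dualAddCommGroup : AddCommGroup (↥Γ)ᵒᵈ := inferInstance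

theorem dualIsOrderedAddMonoid : IsOrderedAddMonoid (↥Γ)ᵒᵈ := inferInstance

theorem dualIsOrderedCancelAddMonoid : IsOrderedCancelAddMonoid (↥Γ)ᵒᵈ := inferInstance

@[reducible] def genSeriesField : Field (GenSeries Γ) := inferInstance

@[reducible] def genSeriesCommRing : CommRing (GenSeries Γ) := inferInstance

end

section
variable {Φ : Type*} [LinearOrder Φ] {Γ : AddSubgroup (HahnGroup Φ)}
attribute [local instance] genSeriesCommRing genSeriesField dualLinearOrder dualAddCommGroup
  dualIsOrderedAddMonoid dualIsOrderedCancelAddMonoid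

theorem exists_ne_zero_of_finsum_ne_zero {ι M : Type*} [AddCommMonoid M] {f : ι → M}
    (h : ∑ᶠ i, f i ≠ 0) : ∃ i, f i ≠ 0 := by
  by_contra! hf
  exact h (finsum_eq_zero_of_forall_eq_zero hf)

/-! ### Partial derivations with respect to the exponents -/

/-- The strongly linear map `α ↦ α_φ α`. -/
def expDeriv (φ : Φ) (a : GenSeries Γ) : GenSeries Γ where
  coeff x := exponent ((OrderDual.ofDual x : Γ) : HahnGroup Φ) φ * a.coeff x
  isPWO_support' := a.isPWO_support.mono fun _ hx => right_ne_zero_of_mul hx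

theorem coeff_expDeriv (φ : Φ) (a : GenSeries Γ) (x : (↥Γ)ᵒᵈ) : (expDeriv φ a).coeff x =
    exponent ((OrderDual.ofDual x : Γ) : HahnGroup Φ) φ * a.coeff x := rfl

theorem expDeriv_add (φ : Φ) (a b : GenSeries Γ) :
    expDeriv φ (a + b) = expDeriv φ a + expDeriv φ b := by
  ext x
  simp [coeff_expDeriv, mul_add]

theorem expDeriv_mul (φ : Φ) (a b : GenSeries Γ) :
    expDeriv φ (a * b) = a * expDeriv φ b + b * expDeriv φ a := by
  rw [mul_comm b]
  ext x
  have hsub : ∀ c : GenSeries Γ, (expDeriv φ c).support ⊆ c.support :=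
    fun c y hy => right_ne_zero_of_mul hy
  -- Both products are expanded over the supports of a and b themselves, so that the three sums have
  -- the same index set. What remains is additivity of the exponent.
  rw [coeff_add, coeff_expDeriv, coeff_mul, coeff_mul_right' b.isPWO_support (hsub b),
    coeff_mul_left' a.isPWO_support (hsub a), Finset.mul_sum, ← Finset.sum_add_distrib]
  refine Finset.sum_congr rfl fun p hp => ?_
  have hx : p.1 + p.2 = x := (Finset.mem_antidiagonal.mp hp).2.2
  have he : exponent ((OrderDual.ofDual x : Γ) : HahnGroup Φ) φ =
      exponent ((OrderDual.ofDual p.1 : Γ) : HahnGroup Φ) φ +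
        exponent ((OrderDual.ofDual p.2 : Γ) : HahnGroup Φ) φ := by
    rw [← hx]
    rfl
  rw [he, coeff_expDeriv, coeff_expDeriv]
  ring

theorem monTerm_mul_monTerm (r s : ℝ) (α β : Γ) :
    monTerm r α * monTerm s β = monTerm (r * s) (α + β) := by
  unfold monTerm
  rw [single_mul_single]
  rfl

theorem monTerm_ne_zero {r : ℝ} (hr : r ≠ 0) (α : Γ) : monTerm r α ≠ 0 :=
  single_ne_zero hr

theorem smul_monTerm (r s : ℝ) (α : Γ) : r • monTerm s α = monTerm (r * s) α := by
  ext x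
  by_cases h : x = OrderDual.toDual α
  · simp [monTerm, h]
  · simp [monTerm, h]

theorem monTerm_div_monTerm (r s : ℝ) (α β : Γ) :
    monTerm r α / monTerm s β = monTerm (r / s) (α - β) := by
  unfold monTerm
  rw [single_div_single]
  rfl

theorem expDeriv_monTerm (φ : Φ) (r : ℝ) (α : Γ) :
    expDeriv φ (monTerm r α) = monTerm (exponent (α : HahnGroup Φ) φ * r) α := by
  ext x
  rw [coeff_expDeriv]
  by_cases h : x = OrderDual.toDual α
  · simp [monTerm, h]
  · simp [monTerm, h]

theorem coeff_monTerm_mul (r : ℝ) (α : Γ) (a : GenSeries Γ) (γ : Γ) :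
    (monTerm r α * a).coeff (OrderDual.toDual γ) = r * a.coeff (OrderDual.toDual (γ - α)) :=
  coeff_single_mul

/-! ### The derivation attached to a Hardy map -/

variable {θ : Φ → Γ} (hθ : IsHardyMap θ) (t : Φ → ℝ)

theorem coeff_monTerm_mul_expDeriv (φ : Φ) (a : GenSeries Γ) (γ : Γ) :
    (monTerm (t φ) (θ φ) * expDeriv φ a).coeff (OrderDual.toDual γ) =
      t φ * (exponent ((γ - θ φ : Γ) : HahnGroup Φ) φ *
        a.coeff (OrderDual.toDual (γ - θ φ))) :=
  coeff_monTerm_mul _ _ _ _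

theorem exists_of_coeff_ne_zero {φ : Φ} {a : GenSeries Γ} {x : (↥Γ)ᵒᵈ}
    (hx : (monTerm (t φ) (θ φ) * expDeriv φ a).coeff x ≠ 0) :
    ∃ α : Γ, OrderDual.toDual α ∈ a.support ∧ exponent (α : HahnGroup Φ) φ ≠ 0 ∧
      x = OrderDual.toDual (α + θ φ) := by
  have h1 := right_ne_zero_of_mul ((coeff_monTerm_mul_expDeriv t φ a (OrderDual.ofDual x)) ▸ hx)
  exact ⟨OrderDual.ofDual x - θ φ, right_ne_zero_of_mul h1, left_ne_zero_of_mul h1, by simp⟩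

/-- The family `φ ↦ t_φ θ^(φ) ∂_φ a`, where `∂_φ α = α_φ α`. -/
def derivFamily (a : GenSeries Γ) : SummableFamily (↥Γ)ᵒᵈ ℝ Φ where
  toFun φ := monTerm (t φ) (θ φ) * expDeriv φ a
  isPWO_iUnion_support' := (hθ.isPWO_image a.isPWO_support).mono fun x hx => by
    obtain ⟨φ, hφ⟩ := Set.mem_iUnion.mp hx
    obtain ⟨α, h1, h2, h3⟩ := exists_of_coeff_ne_zero t hφ
    exact ⟨α, φ, h1, h2, h3⟩
  finite_co_support' x := (hθ.finite_fiber a.isPWO_support (OrderDual.ofDual x)).subset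
    fun φ hφ => by
      obtain ⟨α, h1, h2, rfl⟩ := exists_of_coeff_ne_zero t hφ
      simpa using And.intro h1 h2

theorem derivFamily_apply (a : GenSeries Γ) (φ : Φ) :
    derivFamily hθ t a φ = monTerm (t φ) (θ φ) * expDeriv φ a := rfl

theorem derivFamily_add (a b : GenSeries Γ) :
    derivFamily hθ t (a + b) = derivFamily hθ t a + derivFamily hθ t b := by
  ext1 φ
  rw [SummableFamily.add_apply, derivFamily_apply, derivFamily_apply, derivFamily_apply,
    expDeriv_add, mul_add]

theorem derivFamily_mul (a b : GenSeries Γ) :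
    derivFamily hθ t (a * b) = a • derivFamily hθ t b + b • derivFamily hθ t a := by
  ext1 φ
  rw [SummableFamily.add_apply, SummableFamily.smul_apply, SummableFamily.smul_apply,
    of_symm_smul_of_eq_mul, of_symm_smul_of_eq_mul, derivFamily_apply, derivFamily_apply,
    derivFamily_apply, expDeriv_mul]
  ring

/-- The derivation `a ↦ ∑_φ t_φ θ^(φ) ∂_φ a`. -/
def hardyDeriv : Derivation ℤ (GenSeries Γ) (GenSeries Γ) :=
  Derivation.mk'
    (AddMonoidHom.toIntLinearMap (AddMonoidHom.mk' (fun a => (derivFamily hθ t a).hsum)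
      fun a b => by rw [derivFamily_add, SummableFamily.hsum_add]))
    fun a b => by
      change (derivFamily hθ t (a * b)).hsum =
        a * (derivFamily hθ t b).hsum + b * (derivFamily hθ t a).hsum
      rw [derivFamily_mul, SummableFamily.hsum_add, SummableFamily.hsum_smul,
        SummableFamily.hsum_smul]

theorem hardyDeriv_apply (a : GenSeries Γ) :
    hardyDeriv hθ t a = (derivFamily hθ t a).hsum := rfl

theorem coeff_hardyDeriv (a : GenSeries Γ) (γ : Γ) :
    (hardyDeriv hθ t a).coeff (OrderDual.toDual γ) =
      ∑ᶠ φ, t φ * (exponent ((γ - θ φ : Γ) : HahnGroup Φ) φ *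
        a.coeff (OrderDual.toDual (γ - θ φ))) := by
  rw [hardyDeriv_apply, SummableFamily.coeff_hsum]
  exact finsum_congr fun φ => coeff_monTerm_mul_expDeriv t φ a γ

/-- `hardyDeriv` maps summable families to summable families. -/
def hardyDerivFamily {ι : Type*} (f : SummableFamily (↥Γ)ᵒᵈ ℝ ι) :
    SummableFamily (↥Γ)ᵒᵈ ℝ ι where
  toFun i := hardyDeriv hθ t (f i)
  isPWO_iUnion_support' := (hθ.isPWO_image f.isPWO_iUnion_support).mono fun x hx => by
    obtain ⟨i, hi⟩ := Set.mem_iUnion.mp hx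
    obtain ⟨φ, hφ⟩ := Set.mem_iUnion.mp (SummableFamily.support_hsum_subset hi)
    obtain ⟨α, h1, h2, h3⟩ := exists_of_coeff_ne_zero t hφ
    exact ⟨α, φ, Set.mem_iUnion.mpr ⟨i, h1⟩, h2, h3⟩
  finite_co_support' x := by
    refine ((hθ.finite_fiber f.isPWO_iUnion_support (OrderDual.ofDual x)).biUnion
      fun φ _ => f.finite_co_support (OrderDual.toDual (OrderDual.ofDual x - θ φ))).subset ?_
    intro i hi
    obtain ⟨φ, hφ⟩ := exists_ne_zero_of_finsum_ne_zero
      ((coeff_hardyDeriv hθ t (f i) (OrderDual.ofDual x)).symm.trans_ne hi)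
    have h1 := right_ne_zero_of_mul hφ
    exact Set.mem_biUnion (x := φ)
      ⟨Set.mem_iUnion.mpr ⟨i, right_ne_zero_of_mul h1⟩, left_ne_zero_of_mul h1⟩
      (right_ne_zero_of_mul h1)

theorem hardyDerivFamily_apply {ι : Type*} (f : SummableFamily (↥Γ)ᵒᵈ ℝ ι) (i : ι) :
    hardyDerivFamily hθ t f i = hardyDeriv hθ t (f i) := rfl

/-- Strong linearity is an exchange of two sums. For a fixed γ, `finite_fiber` applied to the union
of the supports gives one finite set of φ that works for every index i. -/
theorem hardyDeriv_hsum {ι : Type*} (f : SummableFamily (↥Γ)ᵒᵈ ℝ ι) :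
    hardyDeriv hθ t f.hsum = (hardyDerivFamily hθ t f).hsum := by
  ext x
  obtain ⟨γ, rfl⟩ := OrderDual.toDual.surjective x
  have hT := hθ.finite_fiber f.isPWO_iUnion_support γ
  have hzero : ∀ i, ∀ φ ∉ hT.toFinset, t φ * (exponent ((γ - θ φ : Γ) : HahnGroup Φ) φ *
      (f i).coeff (OrderDual.toDual (γ - θ φ))) = 0 := by
    intro i φ hφ
    by_contra hne
    have h1 := right_ne_zero_of_mul hne
    exact hφ (hT.mem_toFinset.mpr
      ⟨Set.mem_iUnion.mpr ⟨i, right_ne_zero_of_mul h1⟩, left_ne_zero_of_mul h1⟩)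
  rw [coeff_hardyDeriv, SummableFamily.coeff_hsum]
  simp_rw [hardyDerivFamily_apply, coeff_hardyDeriv, SummableFamily.coeff_hsum, mul_finsum]
  have h1 : ∀ i, ∑ᶠ φ, t φ * (exponent ((γ - θ φ : Γ) : HahnGroup Φ) φ *
      (f i).coeff (OrderDual.toDual (γ - θ φ))) =
      ∑ φ ∈ hT.toFinset, t φ * (exponent ((γ - θ φ : Γ) : HahnGroup Φ) φ *
      (f i).coeff (OrderDual.toDual (γ - θ φ))) := fun i =>
    finsum_eq_sum_of_support_subset _ fun φ hφ => by
      by_contra hn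
      exact hφ (hzero i φ hn)
  simp_rw [h1]
  rw [finsum_sum_comm]
  · refine finsum_eq_sum_of_support_subset _ fun φ hφ => ?_
    obtain ⟨i, hi⟩ := exists_ne_zero_of_finsum_ne_zero hφ
    by_contra hn
    exact hi (hzero i φ hn)
  · exact fun φ _ => (f.finite_co_support (OrderDual.toDual (γ - θ φ))).subset
      fun i hi => right_ne_zero_of_mul (right_ne_zero_of_mul hi)

end

section
variable {Φ : Type*} [LinearOrder Φ] {Γ : AddSubgroup (HahnGroup Φ)}
attribute [local instance] genSeriesCommRing genSeriesField dualLinearOrder dualAddCommGroup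
  dualIsOrderedAddMonoid dualIsOrderedCancelAddMonoid
variable {θ : Φ → Γ} (hθ : IsHardyMap θ) (t : Φ → ℝ)

/-! ### Constants, monomials and the series derivation axioms -/

theorem C_eq_monTerm (r : ℝ) : (C r : GenSeries Γ) = monTerm r 0 := rfl

theorem hardyDeriv_C (r : ℝ) : hardyDeriv hθ t (C r) = 0 := by
  have h : derivFamily hθ t (C r) = 0 := by
    ext1 φ
    rw [derivFamily_apply, C_eq_monTerm, expDeriv_monTerm]
    simp [monTerm]
  rw [hardyDeriv_apply, h, SummableFamily.hsum_zero]

theorem hardyDeriv_C_mul (r : ℝ) (a : GenSeries Γ) :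
    hardyDeriv hθ t (C r * a) = C r * hardyDeriv hθ t a := by
  rw [Derivation.leibniz, hardyDeriv_C, smul_zero, add_zero, smul_eq_mul]

theorem C_mul_monTerm (r s : ℝ) (α : Γ) : (C r : GenSeries Γ) * monTerm s α = monTerm (r * s) α := by
  rw [C_eq_monTerm, monTerm_mul_monTerm, zero_add]

theorem monTerm_eq_C_mul (r : ℝ) (α : Γ) : monTerm r α = (C r : GenSeries Γ) * monTerm 1 α := by
  rw [C_mul_monTerm, mul_one]

variable (hΓ : ContainsFund Γ)

theorem hardyDeriv_fundSeries (φ : Φ) :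
    hardyDeriv hθ t (fundSeries hΓ φ) = monTerm (t φ) (θ φ) * fundSeries hΓ φ := by
  classical
  have h : derivFamily hθ t (fundSeries hΓ φ) =
      SummableFamily.single φ (monTerm (t φ) (θ φ) * fundSeries hΓ φ) := by
    ext1 ψ
    rw [derivFamily_apply]
    unfold fundSeries
    rw [expDeriv_monTerm]
    have h1 : ((fundMon hΓ φ : Γ) : HahnGroup Φ) = fund φ := rfl
    by_cases hψ : ψ = φ
    · subst hψ
      rw [h1, exponent_fund_self, mul_one]
      simp [SummableFamily.single]
    · rw [h1, exponent_fund_of_ne hψ]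
      simp [SummableFamily.single, hψ, monTerm]
  rw [hardyDeriv_apply, h, SummableFamily.hsum_single]

theorem fundSeries_ne_zero (φ : Φ) : fundSeries hΓ φ ≠ 0 := monTerm_ne_zero one_ne_zero _

theorem logDerivFund_hardyDeriv (φ : Φ) :
    logDerivFund hΓ (hardyDeriv hθ t) φ = monTerm (t φ) (θ φ) := by
  unfold logDerivFund
  rw [hardyDeriv_fundSeries, mul_div_cancel_right₀ _ (fundSeries_ne_zero hΓ φ)]

/-- The family `φ ↦ α_φ t_φ θ^(φ)`. -/
def leibnizFamily (α : Γ) : SummableFamily (↥Γ)ᵒᵈ ℝ Φ :=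
  -- Summability is inherited by dividing the derivative family of α by α.
  (monTerm 1 (-α) : GenSeries Γ) • derivFamily hθ t (monTerm 1 α)

theorem leibnizFamily_apply (α : Γ) (φ : Φ) : leibnizFamily hθ t α φ =
    exponent (α : HahnGroup Φ) φ • (monTerm (t φ) (θ φ) : GenSeries Γ) := by
  unfold leibnizFamily
  rw [SummableFamily.smul_apply, of_symm_smul_of_eq_mul, derivFamily_apply, expDeriv_monTerm,
    monTerm_mul_monTerm, monTerm_mul_monTerm, smul_monTerm]
  congr 1
  · ring
  · abel

theorem hardyDeriv_monTerm_one (α : Γ) :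
    hardyDeriv hθ t (monTerm 1 α) = monTerm 1 α * (leibnizFamily hθ t α).hsum := by
  unfold leibnizFamily
  rw [SummableFamily.hsum_smul, ← mul_assoc, monTerm_mul_monTerm, hardyDeriv_apply,
    add_neg_cancel, mul_one, ← C_eq_monTerm, C_one, one_mul]

/-- The family of the terms of a series. -/
def termFamily (a : GenSeries Γ) : SummableFamily (↥Γ)ᵒᵈ ℝ Γ where
  toFun α := monTerm (a.coeff (OrderDual.toDual α)) α
  isPWO_iUnion_support' := a.isPWO_support.mono fun x hx => by
    obtain ⟨α, hα⟩ := Set.mem_iUnion.mp hx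
    have h1 : x = OrderDual.toDual α := support_single_subset hα
    rw [h1] at hα ⊢
    have h2 : (monTerm (a.coeff (OrderDual.toDual α)) α).coeff (OrderDual.toDual α) ≠ 0 := hα
    rwa [monTerm, coeff_single_same] at h2
  finite_co_support' x := (Set.finite_singleton (OrderDual.ofDual x)).subset fun α hα => by
    by_contra hne
    exact hα (coeff_single_of_ne fun h => hne (by rw [h]; rfl))

theorem termFamily_apply (a : GenSeries Γ) (α : Γ) :
    termFamily a α = monTerm (a.coeff (OrderDual.toDual α)) α := rfl

theorem hsum_termFamily (a : GenSeries Γ) : (termFamily a).hsum = a := by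
  ext x
  obtain ⟨γ, rfl⟩ := OrderDual.toDual.surjective x
  rw [SummableFamily.coeff_hsum, finsum_eq_single _ γ]
  · rw [termFamily_apply]
    exact coeff_single_same _ _
  · intro α hα
    exact coeff_single_of_ne fun h => hα (OrderDual.toDual.injective h).symm

theorem isSeriesDerivation_hardyDeriv : IsSeriesDerivation hΓ (hardyDeriv hθ t) where
  map_one := Derivation.map_one_eq_zero _
  strong_leibniz α := ⟨(leibnizFamily hθ t α).hsum, ⟨leibnizFamily hθ t α, fun φ => by
    rw [leibnizFamily_apply]
    exact congrArg _ (logDerivFund_hardyDeriv hθ t hΓ φ).symm, rfl⟩,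
    hardyDeriv_monTerm_one hθ t α⟩
  strong_linear a := ⟨hardyDerivFamily hθ t (termFamily a), fun α => by
    rw [hardyDerivFamily_apply, termFamily_apply, monTerm_eq_C_mul, hardyDeriv_C_mul,
      C_mul_eq_smul], by rw [← hardyDeriv_hsum, hsum_termFamily]⟩

theorem isMonomialDeriv_hardyDeriv (ht : ∀ φ, t φ ≠ 0) :
    IsMonomialDeriv hΓ (hardyDeriv hθ t) := fun φ =>
  ⟨t φ, θ φ + fundMon hΓ φ, ht φ, by
    rw [hardyDeriv_fundSeries]
    unfold fundSeries
    rw [monTerm_mul_monTerm, mul_one]⟩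

/-! ### Log-compatibility -/

/-- Differentiating the logarithmic series termwise, which strong linearity permits, yields ε' times
the geometric series in -ε. -/
theorem hardyDeriv_logOneAdd {ε : GenSeries Γ} (hε : 0 < ε.orderTop) :
    hardyDeriv hθ t (logOneAdd ε) = hardyDeriv hθ t ε / (1 + ε) := by
  have hε' : 0 < (-ε).orderTop := by rwa [orderTop_neg]
  have hgeom := SummableFamily.one_sub_self_mul_hsum_powers hε'
  rw [sub_neg_eq_add] at hgeom
  have hne : (1 + ε) ≠ 0 := left_ne_zero_of_mul_eq_one hgeom
  have hfam : hardyDerivFamily hθ t (SummableFamily.smulFamily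
      (fun n : ℕ => if n = 0 then (0 : ℝ) else (-1) ^ (n - 1) / (n : ℝ))
      (SummableFamily.powers ε)) =
      -- The term of index 0 vanishes and the term of index n + 1 has derivative ε'(-ε)^n, hence the
      -- reindexing by `Nat.succ`.
      (hardyDeriv hθ t ε • SummableFamily.powers (-ε)).embDomain
        ⟨Nat.succ, Nat.succ_injective⟩ := by
    ext1 n
    have happ : hardyDerivFamily hθ t (SummableFamily.smulFamily
      (fun n : ℕ => if n = 0 then (0 : ℝ) else (-1) ^ (n - 1) / (n : ℝ))
      (SummableFamily.powers ε)) n = hardyDeriv hθ t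
        ((if n = 0 then (0 : ℝ) else (-1) ^ (n - 1) / (n : ℝ)) • SummableFamily.powers ε n) := rfl
    rw [happ, SummableFamily.powers_of_orderTop_pos hε, ← C_mul_eq_smul, hardyDeriv_C_mul]
    cases n with
    | zero =>
      rw [SummableFamily.embDomain_of_notMem_range]
      · simp
      · rintro ⟨m, hm⟩
        exact Nat.succ_ne_zero m hm
    | succ n =>
      have himg := SummableFamily.embDomain_image (hardyDeriv hθ t ε • SummableFamily.powers (-ε))
        (f := ⟨Nat.succ, Nat.succ_injective⟩) (a := n)
      refine Eq.trans ?_ himg.symm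
      rw [SummableFamily.smul_apply, of_symm_smul_of_eq_mul,
        SummableFamily.powers_of_orderTop_pos hε', Derivation.leibniz_pow, neg_pow ε n,
        if_neg (Nat.succ_ne_zero n), Nat.succ_sub_one, smul_eq_mul, nsmul_eq_mul, ← mul_assoc]
      have hC : (C ((-1) ^ n / ((n + 1 : ℕ) : ℝ)) : GenSeries Γ) * ((n + 1 : ℕ) : GenSeries Γ) =
          (-1) ^ n := by
        rw [← map_natCast (C : ℝ →+* GenSeries Γ), ← map_mul,
          div_mul_cancel₀ _ (Nat.cast_ne_zero.mpr (Nat.succ_ne_zero n)),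
          map_pow, map_neg, map_one]
      rw [hC]
      ring
  unfold logOneAdd
  rw [hardyDeriv_hsum, hfam, SummableFamily.hsum_embDomain, SummableFamily.hsum_smul,
    eq_div_iff hne, mul_assoc, mul_comm _ (1 + ε), hgeom, mul_one]

theorem orderTop_eq_LM {a : GenSeries Γ} (ha : a ≠ 0) :
    a.orderTop = (OrderDual.toDual (LM a) : (↥Γ)ᵒᵈ) :=
  (order_eq_orderTop_of_ne_zero ha).symm

theorem orderTop_div_eq {a b : GenSeries Γ} {x y : Γ}
    (ha : a.orderTop = (OrderDual.toDual (x + y) : (↥Γ)ᵒᵈ))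
    (hb : b.orderTop = (OrderDual.toDual y : (↥Γ)ᵒᵈ)) :
    (a / b).orderTop = (OrderDual.toDual x : (↥Γ)ᵒᵈ) := by
  have hb0 : b ≠ 0 := by
    rintro rfl
    simp at hb
  have h1 : (a / b).orderTop + b.orderTop = a.orderTop := by
    rw [← orderTop_mul, div_mul_cancel₀ _ hb0]
  rw [ha, hb] at h1
  refine WithTop.add_right_cancel (z := ((OrderDual.toDual y : (↥Γ)ᵒᵈ) : WithTop (↥Γ)ᵒᵈ))
    (WithTop.coe_ne_top) ?_
  rw [h1]
  rfl

theorem orderTop_one_unit_pos {a : GenSeries Γ} (ha : a ≠ 0) :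
    0 < (a / monTerm (LC a) (LM a) - 1).orderTop := by
  have hLC : LC a ≠ 0 := leadingCoeff_ne_zero.mpr ha
  rw [orderTop_self_sub_one_pos_iff]
  constructor
  · refine orderTop_div_eq (x := 0) ?_ (orderTop_single hLC)
    rw [zero_add, orderTop_eq_LM ha]
  · have h1 : (a / monTerm (LC a) (LM a)).leadingCoeff * LC a = LC a := by
      have h2 : (monTerm (LC a) (LM a)).leadingCoeff = LC a := leadingCoeff_of_single
      nth_rewrite 2 [← h2]
      rw [← leadingCoeff_mul, div_mul_cancel₀ _ (monTerm_ne_zero hLC _)]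
      rfl
    exact (mul_eq_right₀ hLC).mp h1

theorem isLogCompatible_hardyDeriv {σ : Φ ≃o Φ} (hθσ : ∀ φ, θ (σ φ) + fundMon hΓ (σ φ) = θ φ)
    (htσ : ∀ φ, t (σ φ) = t φ) : IsLogCompatible hΓ σ (hardyDeriv hθ t) := by
  intro a hLC
  have ha : a ≠ 0 := leadingCoeff_ne_zero.mp hLC.ne'
  have hε := orderTop_one_unit_pos ha
  have hm : monTerm (LC a) (LM a) ≠ 0 := monTerm_ne_zero hLC.ne' _
  have hm1 : (monTerm 1 (LM a) : GenSeries Γ) ≠ 0 := monTerm_ne_zero one_ne_zero _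
  -- Termwise, σ(φ)' = t_{σφ} θ^(σφ) σ(φ) = t_φ θ^(φ), by the two invariance hypotheses.
  have hsec : hardyDeriv hθ t (prelogSection hΓ σ (LM a)) = (leibnizFamily hθ t (LM a)).hsum := by
    unfold prelogSection
    rw [hardyDeriv_hsum]
    congr 1
    ext1 φ
    have happ : hardyDerivFamily hθ t (prelogFamily hΓ σ (LM a)) φ = hardyDeriv hθ t
      (monTerm (exponent (LM a : HahnGroup Φ) φ) (fundMon hΓ (σ φ))) := rfl
    have hfund := hardyDeriv_fundSeries hθ t hΓ (σ φ)
    unfold fundSeries at hfund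
    rw [happ, monTerm_eq_C_mul, hardyDeriv_C_mul, hfund, monTerm_mul_monTerm, hθσ, htσ, mul_one,
      leibnizFamily_apply, C_mul_eq_smul]
  have hda : hardyDeriv hθ t a = hardyDeriv hθ t (a / monTerm (LC a) (LM a)) *
      monTerm (LC a) (LM a) + a * (leibnizFamily hθ t (LM a)).hsum := by
    have h1 : a = a / monTerm (LC a) (LM a) * monTerm (LC a) (LM a) := by
      rw [div_mul_cancel₀ _ hm]
    have h2 : hardyDeriv hθ t (monTerm (LC a) (LM a)) =
        monTerm (LC a) (LM a) * (leibnizFamily hθ t (LM a)).hsum := by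
      rw [monTerm_eq_C_mul, hardyDeriv_C_mul, hardyDeriv_monTerm_one, mul_assoc]
    conv_lhs => rw [h1]
    rw [Derivation.leibniz, h2, smul_eq_mul, smul_eq_mul, ← mul_assoc, div_mul_cancel₀ _ hm]
    ring
  have hd1 : hardyDeriv hθ t (a / monTerm (LC a) (LM a) - 1) =
      hardyDeriv hθ t (a / monTerm (LC a) (LM a)) := by
    rw [map_sub, Derivation.map_one_eq_zero, sub_zero]
  unfold prelog
  rw [map_add, map_add, hardyDeriv_C, zero_add, hsec, hardyDeriv_logOneAdd hθ t hε, hd1, hda,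
    add_sub_cancel]
  field_simp
  ring

end

section
variable {Φ : Type*} [LinearOrder Φ] {Γ : AddSubgroup (HahnGroup Φ)}
attribute [local instance] genSeriesCommRing genSeriesField dualLinearOrder dualAddCommGroup
  dualIsOrderedAddMonoid dualIsOrderedCancelAddMonoid
variable {θ : Φ → Γ} (hθ : IsHardyMap θ) (t : Φ → ℝ) (hΓ : ContainsFund Γ)

/-! ### Hardy type -/

/-- The only delicate case is ψ ≺ φ. There φ occurs in β but not in α, so α/β ≻ 1 has leading
fundamental monomial at or above φ, whereas θ^(φ)/θ^(ψ) is supported below φ and cannot compensate.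
-/
theorem IsHardyMap.add_lt_add (hθ : IsHardyMap θ) {α β : Γ} {φ ψ : Φ}
    (hα : IsLeadingFund (α : HahnGroup Φ) ψ) (hβα : β ≤ α)
    (hφ : exponent (β : HahnGroup Φ) φ ≠ 0) (hne : β = α → φ ≠ ψ) : β + θ φ < α + θ ψ := by
  rcases lt_trichotomy φ ψ with h | h | h
  · exact add_lt_add_of_le_of_lt hβα (hθ _ _ h).1
  · rw [h]
    exact add_lt_add_left (lt_of_le_of_ne hβα fun he => hne he h) _
  · have hα0 := hα.2 φ h
    have hlt : (0 : HahnGroup Φ) < (α : HahnGroup Φ) - β := by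
      refine sub_pos.mpr (lt_of_le_of_ne hβα fun he => ?_)
      rw [← he] at hα0
      exact hφ hα0
    obtain ⟨τ, hτ⟩ := exists_isLeadingFund hlt.ne'
    have hφτ : φ ≤ τ := hτ.le (by rw [exponent_sub, hα0, zero_sub]; exact neg_ne_zero.mpr hφ)
    have hτpos := hτ.pos_iff.mp hlt
    change (β : HahnGroup Φ) + θ φ < (α : HahnGroup Φ) + θ ψ
    refine lt_iff_exponent.mpr ⟨τ, fun x hx => ?_, ?_⟩
    · have h1 := hτ.2 x hx
      rw [exponent_sub] at h1
      rw [exponent_add, exponent_add, (hθ _ _ h).2 x (hφτ.trans hx.le)]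
      linarith
    · rw [exponent_sub] at hτpos
      rw [exponent_add, exponent_add, (hθ _ _ h).2 τ hφτ]
      linarith

/-- By `IsHardyMap.add_lt_add` the pair (LM a, ψ) is the unique maximiser of βθ^(φ) over β in the
support of a and φ in the support of β, so nothing cancels its contribution. -/
theorem orderTop_hardyDeriv (ht : ∀ φ, t φ ≠ 0) {a : GenSeries Γ} (ha : a ≠ 0) {ψ : Φ}
    (hψ : IsLeadingFund (LM a : HahnGroup Φ) ψ) :
    (hardyDeriv hθ t a).orderTop = (OrderDual.toDual (LM a + θ ψ) : (↥Γ)ᵒᵈ) := by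
  have hle : ∀ β : Γ, a.coeff (OrderDual.toDual β) ≠ 0 → β ≤ LM a := fun β hβ =>
    order_le_of_coeff_ne_zero hβ
  refine orderTop_eq_of_le ?_ fun x hx => ?_
  · rw [mem_support, coeff_hardyDeriv, finsum_eq_single _ ψ]
    · rw [add_sub_cancel_right]
      refine mul_ne_zero (ht ψ) (mul_ne_zero hψ.1 ?_)
      exact fun h => ha (coeff_order_eq_zero.mp h)
    · intro φ hφ
      by_contra hne
      have h1 := right_ne_zero_of_mul hne
      have h2 := hθ.add_lt_add hψ (hle _ (right_ne_zero_of_mul h1)) (left_ne_zero_of_mul h1)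
        fun _ => hφ
      rw [sub_add_cancel] at h2
      exact lt_irrefl _ h2
  · obtain ⟨γ, rfl⟩ := OrderDual.toDual.surjective x
    rw [mem_support, coeff_hardyDeriv] at hx
    obtain ⟨φ, hφ⟩ := exists_ne_zero_of_finsum_ne_zero hx
    have h1 := right_ne_zero_of_mul hφ
    by_cases he : γ - θ φ = LM a ∧ φ = ψ
    · rw [← he.1, he.2, sub_add_cancel]
    · have h2 := hθ.add_lt_add hψ (hle _ (right_ne_zero_of_mul h1)) (left_ne_zero_of_mul h1)
        fun h3 h4 => he ⟨h3, h4⟩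
      rw [sub_add_cancel] at h2
      exact OrderDual.toDual_le_toDual.mpr h2.le

theorem exists_isLeadingFund_LM {a : GenSeries Γ} (h : LM a ≠ 0) :
    ∃ ψ, IsLeadingFund (LM a : HahnGroup Φ) ψ :=
  exists_isLeadingFund fun h0 => h (Subtype.ext h0)

theorem LM_ne_zero_of_not_asympEq {a : GenSeries Γ} (ha : a ≠ 0) (h : ¬ AsympEq a 1) :
    LM a ≠ 0 := by
  intro h0
  apply h
  unfold AsympEq
  rw [orderTop_eq_LM ha, h0, orderTop_one]
  rfl

theorem coe_abs_subgroup (γ : Γ) : ((|γ| : Γ) : HahnGroup Φ) = |(γ : HahnGroup Φ)| := by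
  rcases le_total 0 γ with h | h
  · rw [abs_of_nonneg h, abs_of_nonneg (show (0 : HahnGroup Φ) ≤ γ from h)]
  · rw [abs_of_nonpos h, abs_of_nonpos (show (γ : HahnGroup Φ) ≤ 0 from h)]
    rfl

theorem isHardyType_hardyDeriv (ht : ∀ φ, t φ ≠ 0) : IsHardyType (hardyDeriv hθ t) where
  constants a := by
    refine ⟨fun h => ⟨a.coeff 0, ?_⟩, ?_⟩
    · by_contra hne
      -- Removing the constant term keeps the derivative and leaves a series whose leading monomial
      -- is not 1, hence with nonzero derivative.
      have hb : a - C (a.coeff 0) ≠ 0 := sub_ne_zero.mpr hne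
      have hcoeff : (a - C (a.coeff 0)).coeff 0 = 0 := by
        rw [coeff_sub, C_eq_monTerm]
        exact sub_eq_zero.mpr (coeff_single_same _ _).symm
      have hLM : LM (a - C (a.coeff 0)) ≠ 0 := by
        intro h0
        refine hb (coeff_order_eq_zero.mp ?_)
        have h1 : (a - C (a.coeff 0)).order = 0 := h0
        rw [h1, hcoeff]
      obtain ⟨ψ, hψ⟩ := exists_isLeadingFund_LM hLM
      have h1 := orderTop_hardyDeriv hθ t ht hb hψ
      rw [map_sub, hardyDeriv_C, h, sub_zero, orderTop_zero] at h1
      exact WithTop.top_ne_coe h1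
    · rintro ⟨r, rfl⟩
      exact hardyDeriv_C hθ t r
  lhospital a b ha hb ha1 hb1 := by
    obtain ⟨φ, hφ⟩ := exists_isLeadingFund_LM (LM_ne_zero_of_not_asympEq ha ha1)
    obtain ⟨ψ, hψ⟩ := exists_isLeadingFund_LM (LM_ne_zero_of_not_asympEq hb hb1)
    unfold Dominated
    rw [orderTop_hardyDeriv hθ t ht ha hφ, orderTop_hardyDeriv hθ t ht hb hψ, orderTop_eq_LM ha,
      orderTop_eq_LM hb, WithTop.coe_le_coe, WithTop.coe_le_coe, OrderDual.toDual_le_toDual,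
      OrderDual.toDual_le_toDual]
    rcases lt_trichotomy (LM a) (LM b) with h | h | h
    · exact iff_of_true h.le (hθ.add_lt_add hψ h.le hφ.1 fun he => absurd he h.ne).le
    · rw [h] at hφ
      rw [h, hφ.unique hψ]
      exact iff_of_true le_rfl le_rfl
    · exact iff_of_false (not_le.mpr h)
        (not_le.mpr (hθ.add_lt_add hφ h.le hψ.1 fun he => absurd he h.ne))
  log_deriv a b ha hb hpos hlt := by
    obtain ⟨φ, hφ⟩ := exists_isLeadingFund_LM (abs_pos.mp (hpos.trans hlt))
    obtain ⟨ψ, hψ⟩ := exists_isLeadingFund_LM (abs_pos.mp hpos)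
    have hlt' : |(LM b : HahnGroup Φ)| < |(LM a : HahnGroup Φ)| := by
      rw [← coe_abs_subgroup, ← coe_abs_subgroup]
      exact hlt
    have hle := isLeadingFund_le_of_abs_lt hψ hφ hlt'
    have h1 := orderTop_div_eq (x := θ φ) (y := LM a)
      (by rw [orderTop_hardyDeriv hθ t ht ha hφ, add_comm]) (orderTop_eq_LM ha)
    have h2 := orderTop_div_eq (x := θ ψ) (y := LM b)
      (by rw [orderTop_hardyDeriv hθ t ht hb hψ, add_comm]) (orderTop_eq_LM hb)
    unfold Dominated AsympEq Comparable
    rw [h1, h2, LF_eq_LF_iff hφ hψ, WithTop.coe_le_coe, OrderDual.toDual_le_toDual,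
      WithTop.coe_inj, OrderDual.toDual_inj, hθ.strictMono.injective.eq_iff]
    exact ⟨hθ.strictMono.monotone hle, Iff.rfl⟩

/-! ### Necessity of (M) -/

theorem fundMon_pos (φ : Φ) : 0 < fundMon hΓ φ := fund_pos φ

theorem LM_monTerm {r : ℝ} (hr : r ≠ 0) (α : Γ) : LM (monTerm r α) = α := by
  unfold LM monTerm
  rw [order_single hr]
  rfl

theorem LC_monTerm (r : ℝ) (α : Γ) : LC (monTerm r α) = r := leadingCoeff_of_single

theorem orderTop_monTerm {r : ℝ} (hr : r ≠ 0) (α : Γ) :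
    (monTerm r α).orderTop = (OrderDual.toDual α : (↥Γ)ᵒᵈ) := orderTop_single hr

theorem LM_fundSeries (φ : Φ) : LM (fundSeries hΓ φ) = fundMon hΓ φ :=
  LM_monTerm one_ne_zero _

/-! ### What log-compatibility and the Hardy axioms impose on fundamental monomials -/

variable {d : Derivation ℤ (GenSeries Γ) (GenSeries Γ)} {σ : Φ ≃o Φ}

theorem prelogSection_fund (φ : Φ) :
    prelogSection hΓ σ (fundMon hΓ φ) = fundSeries hΓ (σ φ) := by
  classical
  have h : prelogFamily hΓ σ (fundMon hΓ φ) =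
      SummableFamily.single φ (fundSeries hΓ (σ φ)) := by
    ext1 ψ
    change monTerm (exponent (fund φ) ψ) (fundMon hΓ (σ ψ)) = _
    by_cases hψ : ψ = φ
    · subst hψ
      rw [exponent_fund_self]
      simp [SummableFamily.single, fundSeries]
    · rw [exponent_fund_of_ne hψ]
      simp [SummableFamily.single, hψ, monTerm]
  unfold prelogSection
  rw [h, SummableFamily.hsum_single]

theorem logOneAdd_zero : logOneAdd (0 : GenSeries Γ) = 0 := by
  have h : SummableFamily.smulFamily
      (fun n : ℕ => if n = 0 then (0 : ℝ) else (-1) ^ (n - 1) / (n : ℝ))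
      (SummableFamily.powers (0 : GenSeries Γ)) = 0 := by
    ext1 n
    change (if n = 0 then (0 : ℝ) else (-1) ^ (n - 1) / (n : ℝ)) •
      SummableFamily.powers (0 : GenSeries Γ) n = 0
    rw [SummableFamily.powers_of_orderTop_pos (by simp)]
    by_cases hn : n = 0
    · simp [hn]
    · rw [zero_pow hn, smul_zero]
  unfold logOneAdd
  rw [h, SummableFamily.hsum_zero]

theorem prelog_fund (φ : Φ) : prelog hΓ σ (fundSeries hΓ φ) = fundSeries hΓ (σ φ) := by
  have h1 : LC (fundSeries hΓ φ) = 1 := LC_monTerm _ _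
  unfold prelog
  rw [h1, LM_fundSeries, prelogSection_fund, Real.log_one, C_zero, zero_add]
  have h2 : fundSeries hΓ φ / monTerm 1 (fundMon hΓ φ) = 1 := div_self (fundSeries_ne_zero hΓ φ)
  rw [h2, sub_self, logOneAdd_zero, add_zero]

theorem IsLogCompatible.apply_fund (h : IsLogCompatible hΓ σ d) (φ : Φ) :
    d (fundSeries hΓ (σ φ)) = logDerivFund hΓ d φ := by
  have h1 := h (fundSeries hΓ φ) (by
    have h2 : LC (fundSeries hΓ φ) = 1 := LC_monTerm _ _
    rw [h2]
    exact one_pos)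
  rwa [prelog_fund] at h1

theorem monTerm_inj {r s : ℝ} (hr : r ≠ 0) {α β : Γ} (h : monTerm r α = monTerm s β) :
    r = s ∧ α = β := by
  have h1 : r = s := by rw [← LC_monTerm r α, h, LC_monTerm]
  refine ⟨h1, ?_⟩
  rw [← LM_monTerm hr α, h, LM_monTerm (h1 ▸ hr)]

/-- The monomials α and χ are comparable, so (HD3) applies; it requires a strict inequality, hence
the trichotomy. -/
theorem IsHardyType.orderTop_logDeriv (h : IsHardyType d) {α : Γ} {χ : Φ} (h0 : 0 < α)
    (hχ : IsLeadingFund (α : HahnGroup Φ) χ) :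
    (d (monTerm 1 α) / monTerm 1 α).orderTop = (logDerivFund hΓ d χ).orderTop := by
  have ha : (monTerm 1 α : GenSeries Γ) ≠ 0 := monTerm_ne_zero one_ne_zero _
  have hb := fundSeries_ne_zero hΓ χ
  have hLMa : LM (monTerm 1 α : GenSeries Γ) = α := LM_monTerm one_ne_zero _
  have hLMb := LM_fundSeries hΓ χ
  have hfund := fundMon_pos hΓ χ
  have hcomp : LF (α : HahnGroup Φ) = LF (fundMon hΓ χ : HahnGroup Φ) :=
    (LF_eq_LF_iff hχ (isLeadingFund_fund χ)).mpr rfl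
  rcases lt_trichotomy α (fundMon hΓ χ) with hlt | heq | hlt
  · refine ((h.log_deriv _ _ hb ha ?_ ?_).2.mpr ?_).symm
    · rwa [hLMa, abs_of_pos h0]
    · rwa [hLMa, hLMb, abs_of_pos h0, abs_of_pos hfund]
    · unfold Comparable
      rw [hLMa, hLMb, hcomp]
  · rw [heq]
    rfl
  · refine (h.log_deriv _ _ ha hb ?_ ?_).2.mpr ?_
    · rwa [hLMb, abs_of_pos hfund]
    · rwa [hLMa, hLMb, abs_of_pos h0, abs_of_pos hfund]
    · unfold Comparable
      rw [hLMa, hLMb, hcomp]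

theorem IsHardyType.orderTop_deriv_neg (h : IsHardyType d) {α : Γ} {χ : Φ} (h0 : 0 < α)
    (hχ : IsLeadingFund (α : HahnGroup Φ) χ) {r : ℝ} (hr : r ≠ 0) {γ : Γ}
    (hγ : logDerivFund hΓ d χ = monTerm r γ) :
    (d (monTerm 1 (-α))).orderTop = (OrderDual.toDual (-α + γ) : (↥Γ)ᵒᵈ) := by
  have ha : (monTerm 1 α : GenSeries Γ) ≠ 0 := monTerm_ne_zero one_ne_zero _
  have hmul : (monTerm 1 (-α) : GenSeries Γ) * monTerm 1 α = 1 := by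
    rw [monTerm_mul_monTerm, neg_add_cancel, mul_one]
    rfl
  have h1 : d (monTerm 1 (-α)) = -(monTerm 1 (-α) * (d (monTerm 1 α) / monTerm 1 α)) := by
    have h2 := Derivation.leibniz d (monTerm 1 (-α) : GenSeries Γ) (monTerm 1 α)
    rw [hmul, Derivation.map_one_eq_zero, smul_eq_mul, smul_eq_mul] at h2
    field_simp
    linear_combination -h2
  rw [h1, orderTop_neg, orderTop_mul, h.orderTop_logDeriv hΓ h0 hχ, hγ, orderTop_monTerm hr,
    orderTop_monTerm one_ne_zero]
  rfl

/-- Let δ = θ^(ψ)/θ^(φ), with leading fundamental monomial τ. If ψ ≼ τ, then φ ≺ δ, so 1/δ ≺ 1/φ.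
But (1/φ)' ≍ θ^(φ)/φ ≼ θ^(φ) = θ^(ψ)/δ ≼ θ^(τ)/δ ≍ (1/δ)', contradicting l'Hospital's rule. -/
theorem IsHardyType.isHardyMap (h : IsHardyType d) (ht : ∀ φ, t φ ≠ 0)
    (hd : ∀ φ, logDerivFund hΓ d φ = monTerm (t φ) (θ φ)) : IsHardyMap θ := by
  have hmono : StrictMono θ := by
    intro φ ψ hφψ
    have h1 := h.log_deriv (fundSeries hΓ ψ) (fundSeries hΓ φ) (fundSeries_ne_zero hΓ ψ)
      (fundSeries_ne_zero hΓ φ)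
      (by rw [LM_fundSeries, abs_of_pos (fundMon_pos hΓ φ)]; exact fundMon_pos hΓ φ)
      (by
        rw [LM_fundSeries, LM_fundSeries, abs_of_pos (fundMon_pos hΓ φ),
          abs_of_pos (fundMon_pos hΓ ψ)]
        exact fundMon_strictMono hΓ hφψ)
    change Dominated (logDerivFund hΓ d φ) (logDerivFund hΓ d ψ) ∧
      (AsympEq (logDerivFund hΓ d ψ) (logDerivFund hΓ d φ) ↔ _) at h1
    unfold Dominated AsympEq Comparable at h1
    rw [hd, hd, LM_fundSeries, LM_fundSeries, orderTop_monTerm (ht _), orderTop_monTerm (ht _),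
      WithTop.coe_le_coe, OrderDual.toDual_le_toDual, WithTop.coe_inj, OrderDual.toDual_inj] at h1
    refine lt_of_le_of_ne h1.1 fun he => hφψ.ne' ?_
    exact (LF_eq_LF_iff (isLeadingFund_fund ψ) (isLeadingFund_fund φ)).mp (h1.2.mp he.symm)
  intro φ ψ hφψ
  have hlt := hmono hφψ
  refine ⟨hlt, fun χ hχ => ?_⟩
  have hδ : 0 < θ ψ - θ φ := sub_pos.mpr hlt
  obtain ⟨τ, hτ⟩ := exists_isLeadingFund (γ := ((θ ψ - θ φ : Γ) : HahnGroup Φ))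
    (fun h0 => hδ.ne' (Subtype.ext h0))
  by_cases hψτ : ψ ≤ τ
  · exfalso
    have hfδ : fundMon hΓ φ < θ ψ - θ φ :=
      lt_of_isLeadingFund_lt (isLeadingFund_fund φ) hτ (hφψ.trans_le hψτ) hδ
    have hasymp : ∀ α : Γ, 0 < α → ¬ AsympEq (monTerm 1 (-α) : GenSeries Γ) 1 := by
      intro α hα he
      unfold AsympEq at he
      rw [orderTop_monTerm one_ne_zero, orderTop_one] at he
      have h1 : OrderDual.toDual (-α) = (0 : (↥Γ)ᵒᵈ) := WithTop.coe_injective he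
      exact hα.ne' (neg_eq_zero.mp (OrderDual.toDual.injective h1))
    have hne : ∀ α : Γ, (monTerm 1 (-α) : GenSeries Γ) ≠ 0 :=
      fun α => monTerm_ne_zero one_ne_zero _
    have h1 := h.lhospital (monTerm 1 (-fundMon hΓ φ)) (monTerm 1 (-(θ ψ - θ φ))) (hne _) (hne _)
      (hasymp _ (fundMon_pos hΓ φ)) (hasymp _ hδ)
    unfold Dominated at h1
    rw [h.orderTop_deriv_neg hΓ (fundMon_pos hΓ φ) (isLeadingFund_fund φ) (ht φ) (hd φ),
      h.orderTop_deriv_neg hΓ hδ hτ (ht τ) (hd τ), orderTop_monTerm one_ne_zero,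
      orderTop_monTerm one_ne_zero, WithTop.coe_le_coe, WithTop.coe_le_coe,
      OrderDual.toDual_le_toDual, OrderDual.toDual_le_toDual] at h1
    have h2 : -fundMon hΓ φ ≤ -(θ ψ - θ φ) := by
      refine h1.mpr ?_
      have h3 : θ φ = -(θ ψ - θ φ) + θ ψ := by abel
      calc -fundMon hΓ φ + θ φ ≤ θ φ := by
            simpa using (fundMon_pos hΓ φ).le
        _ = -(θ ψ - θ φ) + θ ψ := h3
        _ ≤ -(θ ψ - θ φ) + θ τ := add_le_add_right (hmono.monotone hψτ) _
    exact absurd (neg_le_neg_iff.mp h2) (not_le.mpr hfδ)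
  · have h1 := hτ.2 χ ((not_le.mp hψτ).trans_le hχ)
    have h2 : exponent ((θ ψ : HahnGroup Φ) - (θ φ : HahnGroup Φ)) χ = 0 := h1
    rw [exponent_sub, sub_eq_zero] at h2
    exact h2

end

section
variable {Φ : Type*} [LinearOrder Φ] {Γ : AddSubgroup (HahnGroup Φ)}
attribute [local instance] genSeriesCommRing genSeriesField dualLinearOrder dualAddCommGroup
  dualIsOrderedAddMonoid dualIsOrderedCancelAddMonoid
variable {θ : Φ → Γ} (hΓ : ContainsFund Γ) {σ : Φ ≃o Φ} (hσ : IsDecreasing σ)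

/-! ### Orbits -/

theorem symm_iterate_iterate (φ : Φ) (k : ℕ) : σ.symm^[k] (σ^[k] φ) = φ :=
  (show Function.LeftInverse σ.symm σ from σ.symm_apply_apply).iterate k φ

theorem iterate_symm_iterate (φ : Φ) (k : ℕ) : σ^[k] (σ.symm^[k] φ) = φ :=
  (show Function.LeftInverse σ σ.symm from σ.apply_symm_apply).iterate k φ

/-- Supplies symmetry and transitivity of the orbit relation. -/
theorem mem_zOrbit_iff {φ χ : Φ} : χ ∈ zOrbit σ φ ↔ Equiv.Perm.SameCycle σ.toEquiv φ χ := by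
  have hpow : ∀ (k : ℕ) (ψ : Φ), (σ.toEquiv ^ k : Equiv.Perm Φ) ψ = σ^[k] ψ := fun k ψ =>
    congrFun (Equiv.Perm.iterate_eq_pow σ.toEquiv k).symm ψ
  constructor
  · rintro ⟨k, rfl | rfl⟩
    · exact ⟨k, by rw [zpow_natCast, hpow]⟩
    · refine Equiv.Perm.SameCycle.symm ⟨k, ?_⟩
      rw [zpow_natCast, hpow, iterate_symm_iterate]
  · rintro ⟨i, hi⟩
    obtain ⟨k, rfl | rfl⟩ := i.eq_nat_or_neg
    · exact ⟨k, Or.inl (by rw [← hi, zpow_natCast, hpow])⟩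
    · refine ⟨k, Or.inr ?_⟩
      rw [zpow_neg, zpow_natCast, Equiv.Perm.inv_eq_iff_eq, hpow] at hi
      rw [hi, symm_iterate_iterate]

include hσ in
theorem iterate_mem_convexOrbit {φ ψ : Φ} (h : ψ ∈ Set.Ico φ (σ.symm φ)) (k : ℕ) :
    σ^[k] ψ ∈ convexOrbit σ φ := by
  refine ⟨k + 1, ?_, ?_⟩
  · rw [Function.iterate_succ_apply]
    exact (iterate_strictMono k).monotone ((hσ φ).le.trans h.1)
  · rw [Function.iterate_succ_apply]
    exact (iterate_le hσ ψ k).trans (h.2.le.trans (le_symm_iterate hσ _ k))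

include hσ in
theorem isZOrbitReps_fundDomain {F : Set Φ} (hF : IsConvexOrbitReps σ F) :
    IsZOrbitReps σ (fundDomain σ F) := by
  intro χ
  obtain ⟨φ, ⟨hφF, k, hk1, hk2⟩, -⟩ := hF χ
  -- Start from σ^{-k}(χ) ≽ φ and apply σ until the point falls below φ; the last point before that
  -- lies in [φ, σ⁻¹φ). For termination: k steps return to χ, k more reach a point ≼ φ, and one more
  -- is strictly below.
  have hex : ∃ n : ℕ, σ^[n] (σ.symm^[k] χ) < φ := by
    refine ⟨k + 1 + k, ?_⟩
    rw [Function.iterate_add_apply, iterate_symm_iterate, Function.iterate_succ_apply']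
    have h1 := (iterate_strictMono (σ := σ) k).monotone hk2
    rw [iterate_symm_iterate] at h1
    exact (hσ _).trans_le h1
  classical
  have hpos : 0 < Nat.find hex := by
    rw [Nat.find_pos, Function.iterate_zero, id, not_lt,
      ← (iterate_strictMono (σ := σ) k).le_iff_le, iterate_symm_iterate]
    exact hk1
  obtain ⟨m, hm⟩ := Nat.exists_eq_succ_of_ne_zero hpos.ne'
  have hspec := Nat.find_spec hex
  rw [hm, Function.iterate_succ_apply'] at hspec
  have hmin : φ ≤ σ^[m] (σ.symm^[k] χ) := not_lt.mp (Nat.find_min hex (by omega))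
  have hdom : σ^[m] (σ.symm^[k] χ) ∈ fundDomain σ F :=
    Set.mem_biUnion hφF ⟨hmin, σ.lt_symm_apply.mpr hspec⟩
  have horb : χ ∈ zOrbit σ (σ^[m] (σ.symm^[k] χ)) := by
    have h1 := mem_zOrbit_iff.mp (show σ.symm^[k] χ ∈ zOrbit σ χ from ⟨k, Or.inr rfl⟩)
    have h2 := mem_zOrbit_iff.mp
      (show σ^[m] (σ.symm^[k] χ) ∈ zOrbit σ (σ.symm^[k] χ) from ⟨m, Or.inl rfl⟩)
    exact mem_zOrbit_iff.mpr (h1.trans h2).symm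
  refine ⟨σ^[m] (σ.symm^[k] χ), ⟨hdom, horb⟩, ?_⟩
  -- Points of one ℤ-orbit share a convex orbit, hence the same φ in F; and σ maps [φ, σ⁻¹φ)
  -- strictly below φ, so n = 0.
  have key : ∀ ψ₁ ∈ fundDomain σ F, ∀ ψ₂ ∈ fundDomain σ F, ∀ n : ℕ, ψ₂ = σ^[n] ψ₁ →
      ψ₁ = ψ₂ := by
    rintro ψ₁ h1 ψ₂ h2 n rfl
    obtain ⟨φ₁, hφ₁, h1⟩ := Set.mem_iUnion₂.mp h1
    obtain ⟨φ₂, hφ₂, h2⟩ := Set.mem_iUnion₂.mp h2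
    have he : φ₁ = φ₂ := (hF (σ^[n] ψ₁)).unique
      ⟨hφ₁, iterate_mem_convexOrbit hσ h1 n⟩ ⟨hφ₂, iterate_mem_convexOrbit hσ h2 0⟩
    subst he
    cases n with
    | zero => rfl
    | succ n =>
      exfalso
      rw [Function.iterate_succ_apply] at h2
      have h3 := (h2.1.trans (iterate_le hσ (σ ψ₁) n)).trans_lt (σ.lt_symm_apply.mp h1.2)
      exact lt_irrefl _ h3
  have key2 : ∀ ψ₁ ∈ fundDomain σ F, ∀ ψ₂ ∈ fundDomain σ F, χ ∈ zOrbit σ ψ₁ →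
      χ ∈ zOrbit σ ψ₂ → ψ₁ = ψ₂ := by
    intro ψ₁ h1 ψ₂ h2 hc1 hc2
    have h3 := (mem_zOrbit_iff.mp hc1).trans (mem_zOrbit_iff.mp hc2).symm
    obtain ⟨n, hn | hn⟩ := mem_zOrbit_iff.mpr h3
    · exact key ψ₁ h1 ψ₂ h2 n hn
    · refine (key ψ₂ h2 ψ₁ h1 n ?_).symm
      rw [hn, iterate_symm_iterate]
  rintro ψ ⟨hψ, hχ⟩
  exact key2 ψ hψ _ hdom hχ horb

/-- A function on a set of representatives of the `ℤ`-orbits extends to an invariant function. -/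
theorem exists_invariant_extension {S : Set Φ} (hS : IsZOrbitReps σ S) {t : Φ → ℝ}
    (ht : ∀ ψ ∈ S, t ψ ≠ 0) :
    ∃ u : Φ → ℝ, (∀ ψ, u ψ ≠ 0) ∧ (∀ ψ, u (σ ψ) = u ψ) ∧ ∀ ψ ∈ S, u ψ = t ψ := by
  choose rep hrep huniq using fun χ => hS χ
  refine ⟨fun χ => t (rep χ), fun χ => ht _ (hrep χ).1, fun χ => ?_, fun ψ hψ => ?_⟩
  · have h1 : σ χ ∈ zOrbit σ (rep χ) := mem_zOrbit_iff.mpr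
      ((mem_zOrbit_iff.mp (hrep χ).2).trans (mem_zOrbit_iff.mp ⟨1, Or.inl rfl⟩))
    exact congrArg t (huniq (σ χ) (rep χ) ⟨(hrep χ).1, h1⟩).symm
  · exact congrArg t (huniq ψ ψ ⟨hψ, 0, Or.inl rfl⟩).symm

/-! ### Existence and uniqueness -/

variable {d d₁ d₂ : Derivation ℤ (GenSeries Γ) (GenSeries Γ)}

theorem IsFamilySum.unique {ι : Type*} {f : ι → GenSeries Γ} {s s' : GenSeries Γ}
    (h : IsFamilySum f s) (h' : IsFamilySum f s') : s = s' := by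
  obtain ⟨F, hF, rfl⟩ := h
  obtain ⟨G, hG, rfl⟩ := h'
  have : F = G := SummableFamily.ext fun i => by rw [hF, hG]
  rw [this]

theorem IsSeriesDerivation.ext (h₁ : IsSeriesDerivation hΓ d₁) (h₂ : IsSeriesDerivation hΓ d₂)
    (h : ∀ φ, logDerivFund hΓ d₁ φ = logDerivFund hΓ d₂ φ) : d₁ = d₂ := by
  have hmon : ∀ α : Γ, d₁ (monTerm 1 α) = d₂ (monTerm 1 α) := by
    intro α
    obtain ⟨s₁, hs₁, hd₁⟩ := h₁.strong_leibniz α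
    obtain ⟨s₂, hs₂, hd₂⟩ := h₂.strong_leibniz α
    have hf : (fun φ : Φ => exponent (α : HahnGroup Φ) φ •
        (d₁ (fundSeries hΓ φ) / fundSeries hΓ φ)) = fun φ : Φ => exponent (α : HahnGroup Φ) φ •
        (d₂ (fundSeries hΓ φ) / fundSeries hΓ φ) := funext fun φ => congrArg _ (h φ)
    rw [hf] at hs₁
    rw [hd₁, hd₂, hs₁.unique hs₂]
  refine DFunLike.ext _ _ fun a => ?_
  have hs := h₁.strong_linear a
  simp_rw [hmon] at hs
  exact hs.unique (h₂.strong_linear a)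

theorem IsLogCompatible.logDerivFund_apply (h : IsLogCompatible hΓ σ d) (φ : Φ) :
    logDerivFund hΓ d (σ φ) = logDerivFund hΓ d φ / fundSeries hΓ (σ φ) := by
  unfold logDerivFund
  rw [h.apply_fund]
  rfl

/-- The relation between the logarithmic derivatives at φ and σ(φ) is invertible, so agreement
propagates both ways along each ℤ-orbit. -/
theorem IsLogMonomialHardy.ext {S : Set Φ} (hS : IsZOrbitReps σ S)
    (h₁ : IsLogMonomialHardy hΓ σ d₁) (h₂ : IsLogMonomialHardy hΓ σ d₂)
    (h : ∀ ψ ∈ S, logDerivFund hΓ d₁ ψ = logDerivFund hΓ d₂ ψ) : d₁ = d₂ := by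
  refine IsSeriesDerivation.ext hΓ h₁.series h₂.series fun χ => ?_
  have hstep : ∀ φ, logDerivFund hΓ d₁ φ = logDerivFund hΓ d₂ φ ↔
      logDerivFund hΓ d₁ (σ φ) = logDerivFund hΓ d₂ (σ φ) := by
    intro φ
    rw [h₁.logCompatible.logDerivFund_apply, h₂.logCompatible.logDerivFund_apply,
      div_left_inj' (fundSeries_ne_zero hΓ (σ φ))]
  have hiter : ∀ (k : ℕ) φ, logDerivFund hΓ d₁ φ = logDerivFund hΓ d₂ φ ↔
      logDerivFund hΓ d₁ (σ^[k] φ) = logDerivFund hΓ d₂ (σ^[k] φ) := by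
    intro k φ
    induction k with
    | zero => rfl
    | succ k ih => rw [ih, Function.iterate_succ_apply', hstep]
  obtain ⟨φ, ⟨hφ, k, rfl | rfl⟩, -⟩ := hS χ
  · exact (hiter k φ).mp (h φ hφ)
  · rw [hiter k, iterate_symm_iterate]
    exact h φ hφ

theorem IsLogMonomialHardy.exists_conditionM (h : IsLogMonomialHardy hΓ σ d) :
    ∃ (θ : Φ → Γ) (t : Φ → ℝ), ConditionM hσ θ ∧
      ∀ φ : Φ, t φ ≠ 0 ∧ logDerivFund hΓ d φ = monTerm (t φ) (θ φ) := by
  choose t α ht hd using h.monomial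
  have hlog : ∀ φ, logDerivFund hΓ d φ = monTerm (t φ) (α φ - fundMon hΓ φ) := by
    intro φ
    unfold logDerivFund
    rw [hd]
    unfold fundSeries
    rw [monTerm_div_monTerm, div_one]
  have hmap : IsHardyMap fun φ => α φ - fundMon hΓ φ := h.hardy.isHardyMap t hΓ ht hlog
  refine ⟨_, t, hmap.conditionM hσ fun φ => ?_, fun φ => ⟨ht φ, hlog φ⟩⟩
  have h1 := h.logCompatible.apply_fund hΓ φ
  rw [hd, hlog] at h1
  have h2 : α (σ φ) = α φ - fundMon hΓ φ := (monTerm_inj (ht _) h1).2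
  rw [← h2]
  rfl

theorem ConditionM.isLogMonomialHardy {hσ : IsDecreasing σ} (hθ : ConditionM hσ θ) {t : Φ → ℝ}
    (ht : ∀ φ, t φ ≠ 0) (htσ : ∀ φ, t (σ φ) = t φ) :
    IsLogMonomialHardy hΓ σ (hardyDeriv (hθ.isHardyMap hσ) t) where
  series := isSeriesDerivation_hardyDeriv _ t hΓ
  hardy := isHardyType_hardyDeriv _ t ht
  monomial := isMonomialDeriv_hardyDeriv _ t hΓ ht
  logCompatible := isLogCompatible_hardyDeriv _ t hΓ (fun φ => by
    have h1 := hθ.iterate_eq φ 1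
    simp only [Function.iterate_one, Finset.Icc_self, Finset.sum_singleton] at h1
    refine Subtype.ext ?_
    change (θ (σ φ) : HahnGroup Φ) + fund (σ φ) = θ φ
    rw [h1, sub_add_cancel]) htσ

theorem ConditionM.exists_deriv {hσ : IsDecreasing σ} (hθ : ConditionM hσ θ) {S : Set Φ}
    (hS : IsZOrbitReps σ S) {t : Φ → ℝ} (ht : ∀ ψ ∈ S, t ψ ≠ 0) :
    ∃ d : Derivation ℤ (GenSeries Γ) (GenSeries Γ), IsLogMonomialHardy hΓ σ d ∧
      (∀ ψ ∈ S, logDerivFund hΓ d ψ = monTerm (t ψ) (θ ψ)) ∧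
      ∀ ψ, LM (logDerivFund hΓ d ψ) = θ ψ := by
  obtain ⟨u, hu, huσ, hut⟩ := exists_invariant_extension hS ht
  refine ⟨_, hθ.isLogMonomialHardy hΓ hu huσ, fun ψ hψ => ?_, fun ψ => ?_⟩
  · rw [logDerivFund_hardyDeriv, hut ψ hψ]
  · rw [logDerivFund_hardyDeriv, LM_monTerm (hu ψ)]

/-! ### The case of a single convex orbit -/

theorem orbitRatio_self (φ : Φ) : orbitRatio hσ φ φ = 0 := by
  rw [orbitRatio_eq_sub, sub_self]

theorem orbitRatio_swap (φ ψ : Φ) : orbitRatio hσ φ ψ = -orbitRatio hσ ψ φ := by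
  rw [orbitRatio_eq_sub, orbitRatio_eq_sub, neg_sub]

theorem ConditionM.eq_add_orbitRatio {hσ : IsDecreasing σ} (hθ : ConditionM hσ θ) {φ : Φ}
    (hφ : convexOrbit σ φ = Set.univ) (ψ : Φ) :
    (θ ψ : HahnGroup Φ) = (θ φ : HahnGroup Φ) + orbitRatio hσ ψ φ := by
  -- If ψ ≼ σ^{-k}(φ) and σ^m(φ) ≼ χ, then σ^{m+k}(ψ) ≼ χ: the truncations in (M) lose nothing.
  have hmem : ∀ ψ χ : Φ, χ ∈ geConvexOrbit σ ψ := by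
    intro ψ χ
    obtain ⟨k, -, hk⟩ : ψ ∈ convexOrbit σ φ := hφ ▸ Set.mem_univ ψ
    obtain ⟨m, hm, -⟩ : χ ∈ convexOrbit σ φ := hφ ▸ Set.mem_univ χ
    have h1 := (iterate_strictMono (σ := σ) k).monotone hk
    rw [iterate_symm_iterate] at h1
    refine (mem_geConvexOrbit_iff hσ).mpr ⟨m + k, ?_⟩
    rw [Function.iterate_add_apply]
    exact ((iterate_strictMono (σ := σ) m).monotone h1).trans hm
  have key : ∀ φ ψ : Φ, φ < ψ →
      (θ ψ : HahnGroup Φ) - (θ φ : HahnGroup Φ) = orbitRatio hσ ψ φ := fun φ ψ h =>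
    exponent_ext fun χ => truncation_eq_iff.mp (hθ.trunc_eq φ ψ h) χ (hmem ψ χ)
  rcases lt_trichotomy φ ψ with h | h | h
  · rw [← key φ ψ h, add_sub_cancel]
  · rw [h, orbitRatio_self, add_zero]
  · rw [orbitRatio_swap, ← key ψ φ h, neg_sub, add_sub_cancel]

/-- Condition (M) involves only quotients of values of θ, so a common factor is free; this is the
freedom in choosing θ_0. -/
theorem ConditionM.add_const {hσ : IsDecreasing σ} (hθ : ConditionM hσ θ) (γ : Γ) :
    ConditionM hσ fun φ => θ φ + γ where
  trunc_eq φ ψ h := by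
    rw [← hθ.trunc_eq φ ψ h]
    congr 1
    exact add_sub_add_right_eq_sub (θ ψ : HahnGroup Φ) (θ φ) γ
  iterate_eq φ k := by
    change (θ (σ^[k] φ) : HahnGroup Φ) + γ = (θ φ : HahnGroup Φ) + γ - _
    rw [hθ.iterate_eq φ k]
    abel

theorem IsLogMonomialHardy.LM_logDerivFund (h : IsLogMonomialHardy hΓ σ d) {φ : Φ}
    (hφ : convexOrbit σ φ = Set.univ) (ψ : Φ) :
    (LM (logDerivFund hΓ d ψ) : HahnGroup Φ) =
      (LM (logDerivFund hΓ d φ) : HahnGroup Φ) + orbitRatio hσ ψ φ := by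
  obtain ⟨θ, t, hθ, ht⟩ := h.exists_conditionM hΓ hσ
  rw [(ht ψ).2, (ht φ).2, LM_monTerm (ht ψ).1, LM_monTerm (ht φ).1]
  exact hθ.eq_add_orbitRatio hφ ψ

theorem isConvexOrbitReps_singleton {φ : Φ} (hφ : convexOrbit σ φ = Set.univ) :
    IsConvexOrbitReps σ {φ} := fun χ =>
  ⟨φ, ⟨rfl, hφ ▸ Set.mem_univ χ⟩, fun _ h => h.1⟩

theorem fundDomain_singleton (φ : Φ) : fundDomain σ {φ} = Set.Ico φ (σ.symm φ) := by
  simp [fundDomain]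

end

end

end HahnHardy

/-! ### Assembly of the four statements -/

theorem mainTheorem7 {Φ : Type*} [LinearOrder Φ] (Γ : AddSubgroup (HahnGroup Φ))
    (hΓ : ContainsFund Γ) (σ : Φ ≃o Φ) (hσ : IsDecreasing σ) :
    -- existence criterion
    ((∃ d : Derivation ℤ (GenSeries Γ) (GenSeries Γ), IsLogMonomialHardy hΓ σ d) ↔
      ∃ θ : Φ → Γ, ConditionM hσ θ) ∧
    -- every such derivation comes from a map satisfying (M)
    (∀ d : Derivation ℤ (GenSeries Γ) (GenSeries Γ), IsLogMonomialHardy hΓ σ d →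
      ∃ (θ : Φ → Γ) (t : Φ → ℝ), ConditionM hσ θ ∧
        ∀ φ : Φ, t φ ≠ 0 ∧ logDerivFund hΓ d φ = monTerm (t φ) (θ φ)) ∧
    -- uniqueness up to the choice of the terms `t_ψ θ^(ψ)` on a set of orbit representatives
    (∀ F : Set Φ, IsConvexOrbitReps σ F →
      IsZOrbitReps σ (fundDomain σ F) ∧
      (∀ d₁ d₂ : Derivation ℤ (GenSeries Γ) (GenSeries Γ),
        IsLogMonomialHardy hΓ σ d₁ → IsLogMonomialHardy hΓ σ d₂ →
        (∀ ψ ∈ fundDomain σ F, logDerivFund hΓ d₁ ψ = logDerivFund hΓ d₂ ψ) → d₁ = d₂) ∧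
      (∀ θ : Φ → Γ, ConditionM hσ θ → ∀ t : Φ → ℝ, (∀ ψ ∈ fundDomain σ F, t ψ ≠ 0) →
        ∃! d : Derivation ℤ (GenSeries Γ) (GenSeries Γ), IsLogMonomialHardy hΓ σ d ∧
          ∀ ψ ∈ fundDomain σ F, logDerivFund hΓ d ψ = monTerm (t ψ) (θ ψ))) ∧
    -- the case of a single convex orbit
    (∀ φ : Φ, convexOrbit σ φ = Set.univ →
      (∀ d : Derivation ℤ (GenSeries Γ) (GenSeries Γ), IsLogMonomialHardy hΓ σ d →
        ∀ ψ : Φ, (LM (logDerivFund hΓ d ψ) : HahnGroup Φ) =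
          (LM (logDerivFund hΓ d φ) : HahnGroup Φ) + orbitRatio hσ ψ φ) ∧
      ((∃ d : Derivation ℤ (GenSeries Γ) (GenSeries Γ), IsLogMonomialHardy hΓ σ d) →
        ∀ (θ₀ : Γ) (t : Φ → ℝ), (∀ ψ ∈ Set.Ico φ (σ.symm φ), t ψ ≠ 0) →
          ∃! d : Derivation ℤ (GenSeries Γ) (GenSeries Γ), IsLogMonomialHardy hΓ σ d ∧
            LM (logDerivFund hΓ d φ) = θ₀ ∧
            ∀ ψ ∈ Set.Ico φ (σ.symm φ), LC (logDerivFund hΓ d ψ) = t ψ)) := by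
  refine ⟨⟨?_, ?_⟩, fun d hd => hd.exists_conditionM hΓ hσ, fun F hF => ?_, fun φ hφ => ?_⟩
  · rintro ⟨d, hd⟩
    obtain ⟨θ, -, hθ, -⟩ := hd.exists_conditionM hΓ hσ
    exact ⟨θ, hθ⟩
  · rintro ⟨θ, hθ⟩
    exact ⟨_, hθ.isLogMonomialHardy hΓ (t := fun _ => 1) (fun _ => one_ne_zero) fun _ => rfl⟩
  · have hS := isZOrbitReps_fundDomain hσ hF
    refine ⟨hS, fun d₁ d₂ h₁ h₂ h => h₁.ext hΓ hS h₂ h, fun θ hθ t ht => ?_⟩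
    obtain ⟨d, hd, hdt, -⟩ := hθ.exists_deriv hΓ hS ht
    exact ⟨d, ⟨hd, hdt⟩, fun d' hd' =>
      hd'.1.ext hΓ hS hd fun ψ hψ => (hd'.2 ψ hψ).trans (hdt ψ hψ).symm⟩
  · refine ⟨fun d hd => hd.LM_logDerivFund hΓ hσ hφ, ?_⟩
    rintro ⟨d₀, hd₀⟩ θ₀ t ht
    have hS := isZOrbitReps_fundDomain hσ (isConvexOrbitReps_singleton hφ)
    rw [fundDomain_singleton] at hS
    obtain ⟨θ, -, hθ, -⟩ := hd₀.exists_conditionM hΓ hσ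
    -- Rescaling by θ_0/θ^(φ) gives the prescribed value at φ.
    obtain ⟨d, hd, hdt, hdθ⟩ := (hθ.add_const (θ₀ - θ φ)).exists_deriv hΓ hS ht
    have hdφ : LM (logDerivFund hΓ d φ) = θ₀ := by rw [hdθ, add_sub_cancel]
    refine ⟨d, ⟨hd, hdφ, fun ψ hψ => by rw [hdt ψ hψ, LC_monTerm]⟩, ?_⟩
    rintro d' ⟨hd', hd'φ, hd't⟩
    refine hd'.ext hΓ hS hd fun ψ hψ => ?_
    obtain ⟨θ', t', -, ht'⟩ := hd'.exists_conditionM hΓ hσ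
    -- The value at φ and the orbit ratio determine every leading monomial. As the logarithmic
    -- derivatives are single terms, equal leading coefficients then make them equal.
    have hLM : LM (logDerivFund hΓ d' ψ) = LM (logDerivFund hΓ d ψ) := by
      apply Subtype.ext
      rw [hd'.LM_logDerivFund hΓ hσ hφ, hd.LM_logDerivFund hΓ hσ hφ, hd'φ, hdφ]
    have hLC := hd't ψ hψ
    rw [(ht' ψ).2, LC_monTerm] at hLC
    rw [hdθ, (ht' ψ).2, LM_monTerm (ht' ψ).1] at hLM
    rw [(ht' ψ).2, hdt ψ hψ, hLC, hLM]
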